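/- Setting. A Defender chooses $d\in\mathcal D$, an Attacker observes $d$ and chooses $a\in\mathcal A$, and then an outcome $\theta\in\Theta$ occurs. Each of $\mathcal D,\mathcal A,\Theta$ is either discrete (a non-empty countable set, with counting measure and the 0–1 metric) or an interval in $\mathbb R^n$ (a product of nondegenerate real intervals, bounded or not, with Lebesgue measure and the Euclidean metric); the reference measures are written $\mathrm dd,\mathrm da,\mathrm d\theta$. The Defender has a utility $u_D(d,\theta)$ and conditional densities $p_D(\theta\mid d,a)$. Her uncertainty about the Attacker is given by random utilities $U_A^\omega(a,\theta)$ and random conditional densities $P_A^\omega(\theta\mid d,a)$ on a probability space $(\Omega,P)$ (all measurable). Let $\Psi_A^\omega(d,a)=\int U_A^\omega(a,\theta)P_A^\omega(\theta\mid d,a)\,\mathrm d\theta$, let $A^*(d)^\omega$ be a (jointly measurable) random optimal attack, i.e. for each $d$, almost surely $A^*(d)^\omega\in\arg\max_a\Psi_A^\omega(d,a)$, and let $p_D(\cdot\mid d)$ be the law of $A^*(d)$ under $P$ (so $p_D(a\mid d)=P[A^*(d)=a]$ in the discrete case). Put $\psi_D(d)=\iint u_D(d,\theta)\,p_D(\theta\mid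 d,a)\,p_D(a\mid d)\,\mathrm d\theta\,\mathrm da$; the ARA solution is $d^*_{\rm ARA}=\arg\max_d\psi_D(d)$. Let $g_D(d'\mid d)$ and $g_A(a'\mid a)$ be symmetric proposal densities. Algorithm. Outer loop: from $(d,a,\theta)$ propose $\tilde d\sim g_D(\cdot\mid d)$, $\tilde a\sim p_D(\cdot\mid\tilde d)$, $\tilde\theta\sim p_D(\cdot\mid\tilde d,\tilde a)$, and accept with probability $\min\{1,u_D(\tilde d,\tilde\theta)/u_D(d,\theta)\}$, otherwise stay; it is started from any $d^{(0)}$ with $a^{(0)}\sim p_D(\cdot\mid d^{(0)})$, $\theta^{(0)}\sim p_D(\cdot\mid d^{(0)},a^{(0)})$. Inner sampler for a defense $d$: draw $\omega\sim P$, start from some $a^{(0)}$ with $\theta^{(0)}\sim P_A^\omega(\cdot\mid d,a^{(0)})$, and run $M$ iterations of: from $(a,\theta)$ propose $\tilde a\sim g_A(\cdot\mid a)$, $\tilde\theta\sim P_A^\omega(\cdot\mid d,\tilde a)$, accept with probability $\min\{1,U_A^\omega(\tilde a,\tilde\theta)/U_A^\omega(a,\theta)\}$; discard the first $K$ draws and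 return the sample mode of the $a$-components of the others. The sample mode with bandwidth $h>0$ is the (first) retained draw $x$ that maximizes the number of retained draws in the closed ball $B(x,h)$ divided by the reference measure of $B(x,h)$; on a discrete set with $h<1$ this is the most frequent value. Assume that $u_D$ and, for almost all $\omega$, $U_A^\omega$ are positive; that $p_D(\theta\mid d,a)$ and, for almost all $\omega$, $P_A^\omega(\theta\mid d,a)$ are positive; and that $u_D(d,\theta)p_D(\theta\mid d,a)p_D(a\mid d)$ is integrable in $(d,a,\theta)$ and, for each $d$ and almost all $\omega$, $U_A^\omega(a,\theta)P_A^\omega(\theta\mid d,a)$ is integrable in $(a,\theta)$. Then: (1) For each $d$ and almost all $\omega$, $\pi_A^\omega(a,\theta\mid d)\propto U_A^\omega(a,\theta)P_A^\omega(\theta\mid d,a)$ is a well-defined probability distribution and is stationary for the inner chain. (2) $\pi_D(d,a,\theta)\propto u_D(d,\theta)\,p_D(\theta\mid d,a)\,p_D(a\mid d)$ is a well-defined probability distribution and is stationary for the outer chain. If instead the attacks $\tilde a$ are drawn by the inner sampler with fixed finite $M$, $K$, $h$, $a^{(0)}$, whose output has a law $q(\cdot\mid\tilde d)$ (a Markov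 kernel), the same is true with $q(a\mid d)$ in place of $p_D(a\mid d)$, provided that $u_D(d,\theta)p_D(\theta\mid d,a)q(a\mid d)$ is integrable. Call $x$ a well-separated maximizer of a function $f$ if $f$ is continuous at $x$ and, for each $\varepsilon>0$, $f$ is bounded by a constant smaller than $f(x)$ on the set of points at distance at least $\varepsilon$ from $x$. (For a discrete set and the expected utilities here, this just means that $x$ is the unique maximizer.) (3) Let $g_A$ be irreducible (from each point, every set of positive reference measure is reached with positive probability in some number of steps), let $d\in\mathcal D$, and let $A^*(d)^\omega$ be almost surely a well-separated maximizer of $\Psi_A^\omega(d,\cdot)$. Then for almost all $\omega$ and each $\varepsilon>0$ there is $h_0>0$ such that for all $0<h<h_0$ and all $a^{(0)}$, $K$, almost surely the sample mode with bandwidth $h$ of the inner draws is within $\varepsilon$ of $A^*(d)^\omega$ for all large $M$. Moreover, for all $a^{(0)}$, $K$ there are bandwidths $h_M>0$, $h_M\to0$, for which the law of the attack returned by the inner sampler converges weakly to $p_D(\cdot\mid d)$ as $M\to\infty$. (4) Let $g_D$ be irreducible and let $d^*_{\rm ARA}$ be a well-separated maximizer of $\psi_D$. Then for each $\varepsilon>0$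 there is $h_0>0$ such that for all $0<h<h_0$ and all $d^{(0)}$, $R$, almost surely the sample mode with bandwidth $h$ of the outer draws $d^{(R+1)},\dots,d^{(N)}$ is within $\varepsilon$ of $d^*_{\rm ARA}$ for all large $N$. Moreover, for all $d^{(0)}$, $R$ there are bandwidths $h_N>0$, $h_N\to0$, for which the sample mode of these draws converges to $d^*_{\rm ARA}$ almost surely as $N\to\infty$. -/

import Mathlib

open MeasureTheory ProbabilityTheory Filter Topology
open scoped ENNReal BoundedContinuousFunction

noncomputable section

/-- `S`, with its reference measure `ν`, is either
* a discrete set: a countable set carrying the discrete (0-1) metric and counting measure, or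
* a (nondegenerate) interval in `ℝⁿ`: a product of `n` real intervals with nonempty interiors, each
  open, closed, half-open, bounded or unbounded, carrying the Euclidean metric and Lebesgue
  measure.  (`e` is the inclusion of the interval in `ℝⁿ`.) -/
class IsDiscreteOrInterval {S : Type*} [MetricSpace S] [MeasurableSpace S] [BorelSpace S]
    (ν : Measure S) : Prop where
  discrete_or_interval :
    (Countable S ∧ (∀ x y : S, x ≠ y → dist x y = 1) ∧ ν = Measure.count) ∨
    (∃ (n : ℕ) (I : Fin n → Set ℝ) (e : S → EuclideanSpace ℝ (Fin n)),
      (∀ i, (I i).OrdConnected ∧ (interior (I i)).Nonempty) ∧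
      Isometry e ∧ Set.range e = {x | ∀ i, x i ∈ I i} ∧ ν = Measure.comap e volume)

instance IsDiscreteOrInterval.sigmaFinite {S : Type*} [MetricSpace S] [MeasurableSpace S]
    [BorelSpace S] (ν : Measure S) [h : IsDiscreteOrInterval ν] : SigmaFinite ν := by
  rcases h.discrete_or_interval with ⟨_, _, rfl⟩ | ⟨n, I, e, hI, he, hr, rfl⟩
  · infer_instance
  · have hm : MeasurableSet (Set.range e) := by
      rw [hr, Set.ofPred_forall]
      exact MeasurableSet.iInter fun i =>
        (hI i).1.measurableSet.preimage (by fun_prop)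
    have hemb : MeasurableEmbedding e := he.isEmbedding.measurableEmbedding hm
    have : SigmaFinite ((Measure.comap e volume).map e) := by
      rw [hemb.map_comap]; infer_instance
    exact SigmaFinite.of_map _ hemb.measurable.aemeasurable this

/-- A (jointly measurable) conditional probability density `p (y | x)` with respect to `ν`. -/
structure CondDensity (X : Type*) {Y : Type*} [MeasurableSpace X] [MeasurableSpace Y]
    (ν : Measure Y) where
  /-- `p x y` is the density `p (y | x)` -/
  p : X → Y → ℝ
  measurable_p : Measurable (Function.uncurry p)
  nonneg : ∀ x y, 0 ≤ p x y
  lintegral_eq_one : ∀ x, ∫⁻ y, ENNReal.ofReal (p x y) ∂ν = 1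

namespace CondDensity

variable {X Y : Type*} [MeasurableSpace X] [MeasurableSpace Y] {ν : Measure Y}

/-- The Markov kernel `x ↦ p (y | x) ν(dy)`. -/
def kernel [SFinite ν] (f : CondDensity X ν) : Kernel X Y :=
  (Kernel.const X ν).withDensity fun x y => ENNReal.ofReal (f.p x y)

lemma measurable_ofReal (f : CondDensity X ν) :
    Measurable (Function.uncurry fun x y => ENNReal.ofReal (f.p x y)) :=
  ENNReal.measurable_ofReal.comp f.measurable_p

instance [SFinite ν] (f : CondDensity X ν) : IsMarkovKernel f.kernel := by
  refine ⟨fun x => ⟨?_⟩⟩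
  rw [kernel, Kernel.withDensity_apply' _ f.measurable_ofReal]
  simpa using f.lintegral_eq_one x

/-- The proposal density is symmetric: `g (x' | x) = g (x | x')`. -/
def IsSymmetric (g : CondDensity Y ν) : Prop := ∀ x x', g.p x x' = g.p x' x

end CondDensity

section MetropolisHastings

variable {S : Type*} [MeasurableSpace S]

/-- One step of a Metropolis-Hastings type chain: from the state `s`, propose `s' ∼ Q s`; with
probability `α s s'` move to `s'`, otherwise stay at `s`. -/
def mhKernel (Q : Kernel S S) [IsMarkovKernel Q] (α : S → S → ℝ≥0∞) : Kernel S S :=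
  Q.withDensity α + (Kernel.id).withDensity fun s _ => ∫⁻ s', (1 - α s s') ∂(Q s)

lemma isMarkovKernel_mhKernel (Q : Kernel S S) [IsMarkovKernel Q] (α : S → S → ℝ≥0∞)
    (hα : Measurable (Function.uncurry α)) (h1 : ∀ s s', α s s' ≤ 1) :
    IsMarkovKernel (mhKernel Q α) := by
  have hr : Measurable (Function.uncurry fun (s : S) (_ : S) => ∫⁻ s', (1 - α s s') ∂(Q s)) := by
    have : Measurable fun s => ∫⁻ s', (1 - α s s') ∂(Q s) :=
      Measurable.lintegral_kernel_prod_right (f := fun s s' => 1 - α s s')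
        (measurable_const.sub hα)
    exact this.comp measurable_fst
  refine ⟨fun s => ⟨?_⟩⟩
  rw [mhKernel, _root_.add_apply, Measure.add_apply, Kernel.withDensity_apply' _ hα,
    Kernel.withDensity_apply' _ hr, Kernel.id_apply]
  simp only [Measure.restrict_univ, lintegral_const, measure_univ, mul_one]
  have hs : Measurable (α s) := hα.comp measurable_prodMk_left
  rw [← lintegral_add_left hs]
  simp [add_tsub_cancel_of_le (h1 s _)]

/-- Law of the whole trajectory `s⁽⁰⁾, s⁽¹⁾, …` of the homogeneous Markov chain with initial law
`μ₀` and transition kernel `κ`. -/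
def chainLaw (μ₀ : Measure S) (κ : Kernel S S) [IsMarkovKernel κ] : Measure (ℕ → S) :=
  Kernel.trajMeasure (X := fun _ => S) μ₀ fun n =>
    κ.comap (fun x : (i : Finset.Iic n) → S => x ⟨n, Finset.mem_Iic.2 le_rfl⟩)
      (measurable_pi_apply _)

/-- The probability measure proportional to `m` (for `0 < m univ < ∞`). -/
def normalized (m : Measure S) : Measure S := (m Set.univ)⁻¹ • m

end MetropolisHastings

section APS

variable {X Y : Type*} [MeasurableSpace X] [MeasurableSpace Y]

/-- Given a decision `x`, draw `y ∼ L x`; the result is the pair `(x, y)`. -/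
def drawFrom (L : Kernel X Y) : Kernel X (X × Y) := Kernel.id ×ₖ L

instance (L : Kernel X Y) [IsMarkovKernel L] : IsMarkovKernel (drawFrom L) := by
  unfold drawFrom; infer_instance

/-- Candidate of the augmented probability simulation (APS) sampler at the state `(x, y)`:
`x' ∼ G (· | x)`, then `y' ∼ L (· | x')`. -/
def apsProposal (G : Kernel X X) (L : Kernel X Y) : Kernel (X × Y) (X × Y) :=
  (drawFrom L ∘ₖ G).comap Prod.fst measurable_fst

instance (G : Kernel X X) [IsMarkovKernel G] (L : Kernel X Y) [IsMarkovKernel L] :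
    IsMarkovKernel (apsProposal G L) := by
  unfold apsProposal; infer_instance

/-- Acceptance probability `min {1, u(x', y') / u(x, y)}`. -/
def apsAcceptance (u : X × Y → ℝ) (s s' : X × Y) : ℝ≥0∞ := ENNReal.ofReal (min 1 (u s' / u s))

/-- One iteration of the APS Metropolis-Hastings loop. -/
def apsKernel (G : Kernel X X) [IsMarkovKernel G] (L : Kernel X Y) [IsMarkovKernel L]
    (u : X × Y → ℝ) (_hu : Measurable u) : Kernel (X × Y) (X × Y) :=
  mhKernel (apsProposal G L) (apsAcceptance u)

instance (G : Kernel X X) [IsMarkovKernel G] (L : Kernel X Y) [IsMarkovKernel L]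
    (u : X × Y → ℝ) (hu : Measurable u) : IsMarkovKernel (apsKernel G L u hu) := by
  refine isMarkovKernel_mhKernel _ _ ?_ fun s s' => ?_
  · exact ENNReal.measurable_ofReal.comp
      (measurable_const.min ((hu.comp measurable_snd).div (hu.comp measurable_fst)))
  · exact ENNReal.ofReal_le_one.2 (min_le_left _ _)

/-- Law of the trajectory of the APS sampler started from the decision `x₀`
(with `y⁽⁰⁾ ∼ L (· | x₀)`). -/
def apsRun (G : Kernel X X) [IsMarkovKernel G] (L : Kernel X Y) [IsMarkovKernel L]
    (u : X × Y → ℝ) (hu : Measurable u) (x₀ : X) : Measure (ℕ → X × Y) :=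
  chainLaw (drawFrom L x₀) (apsKernel G L u hu)

end APS

section Mode

variable {S : Type*} [MetricSpace S] [MeasurableSpace S]

/-- Density estimate at the draw `z i`, from the draws `z j`, `K < j ≤ M`: (up to the factor
`1 / (M - K)`) the fraction of these draws at distance at most `h` of `z i`, relative to
the reference measure of that window.  On a discrete set and for `h < 1` it is the
frequency of the value `z i`. -/
def densityScore (ν : Measure S) (h : ℝ) (K M : ℕ) (z : ℕ → S) (i : ℕ) : ℝ≥0∞ :=
  (((Finset.Ioc K M).filter fun j => dist (z j) (z i) ≤ h).card : ℝ≥0∞) /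
    ν (Metric.closedBall (z i) h)

/-- Sample mode with bandwidth `h` of `z (K + 1), …, z M` (the first `K` draws are
discarded): the first of these draws at which the density estimate is largest.  On a
discrete set and for `h < 1`, it is the most frequent value (the value which appears first in case
of ties). -/
def sampleMode (ν : Measure S) (h : ℝ) (K M : ℕ) (z : ℕ → S) : S :=
  z (sInf {i | i ∈ Finset.Ioc K M ∧
    ∀ j ∈ Finset.Ioc K M, densityScore ν h K M z j ≤ densityScore ν h K M z i})

/-- `x` is the unique maximizer of `f`, `f` is continuous at `x`, and `x` is well separated: away
from `x`, `f` stays below a constant smaller than `f x`.  (On a discrete set, for `f` positive and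
summable, this just says that `x` is the unique maximizer.  So it does for a continuous positive
`f` on a compact interval.) -/
def IsWellSeparatedArgmax (f : S → ℝ≥0∞) (x : S) : Prop :=
  ContinuousAt f x ∧ ∀ ε > 0, ∃ c < f x, ∀ y, ε ≤ dist y x → f y ≤ c

end Mode

section ARA

variable {D A Θ Ω : Type*} [MeasurableSpace D] [MeasurableSpace A] [MeasurableSpace Θ]
  [MeasurableSpace Ω]

/-! ### The Attacker's problem, for utility `u` and outcome density `p` (given `d`) -/

/-- Expected utility of the attack `a`: `∫ u(a,θ) p(θ | a) dθ`. -/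
def attackerExpectedUtility (νΘ : Measure Θ) (u p : A → Θ → ℝ) (a : A) : ℝ≥0∞ :=
  ∫⁻ θ, ENNReal.ofReal (u a θ * p a θ) ∂νΘ

/-- The Attacker's augmented distribution `π_A(a,θ) ∝ u(a,θ) p(θ | a)`. -/
def attackerTarget (νA : Measure A) (νΘ : Measure Θ) (u p : A → Θ → ℝ) : Measure (A × Θ) :=
  normalized ((νA.prod νΘ).withDensity fun s => ENNReal.ofReal (u s.1 s.2 * p s.1 s.2))

/-! ### The inner sampler -/

/-- For the type `ω` and the defense `d`, the kernel `a ↦ P_A^ω(θ | d, a) dθ`. -/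
def attackerOutcomeKernel {νΘ : Measure Θ} [SFinite νΘ] (PA : CondDensity (Ω × D × A) νΘ)
    (ω : Ω) (d : D) : Kernel A Θ :=
  PA.kernel.comap (fun a => (ω, d, a)) (by fun_prop)

instance {νΘ : Measure Θ} [SFinite νΘ] (PA : CondDensity (Ω × D × A) νΘ) (ω : Ω) (d : D) :
    IsMarkovKernel (attackerOutcomeKernel PA ω d) := by
  unfold attackerOutcomeKernel; infer_instance

/-- One iteration of the inner APS loop for the sampled utility `U_A^ω` and the sampled
probabilities `P_A^ω`: `a' ∼ g_A(· | a)`, `θ' ∼ P_A^ω(· | d, a')`, accepted with probability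
`min {1, U_A^ω(a', θ') / U_A^ω(a, θ)}`. -/
def innerKernel {νA : Measure A} {νΘ : Measure Θ} [SFinite νA] [SFinite νΘ]
    (gA : CondDensity A νA) (PA : CondDensity (Ω × D × A) νΘ)
    (UA : Ω → A × Θ → ℝ) (hUA : Measurable (Function.uncurry UA)) (ω : Ω) (d : D) :
    Kernel (A × Θ) (A × Θ) :=
  apsKernel gA.kernel (attackerOutcomeKernel PA ω d) (UA ω) (hUA.comp measurable_prodMk_left)

/-- Law of the draws `(a⁽ⁱ⁾, θ⁽ⁱ⁾)` of the inner APS loop, started from the attack `a₀`. -/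
def innerRun {νA : Measure A} {νΘ : Measure Θ} [SFinite νA] [SFinite νΘ]
    (gA : CondDensity A νA) (PA : CondDensity (Ω × D × A) νΘ)
    (UA : Ω → A × Θ → ℝ) (hUA : Measurable (Function.uncurry UA)) (ω : Ω) (d : D) (a₀ : A) :
    Measure (ℕ → A × Θ) :=
  apsRun gA.kernel (attackerOutcomeKernel PA ω d) (UA ω) (hUA.comp measurable_prodMk_left) a₀

/-- Law of the attack returned by the inner sampler for the defense `d`: draw the Attacker's type
`ω ∼ P`, which gives `u_A = U_A^ω` and `p_A = P_A^ω`, run `M` iterations of the inner loop from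
`a₀`, discard the first `K` draws and return the sample mode of the others. -/
def sampleAttack [MetricSpace A] {νA : Measure A} {νΘ : Measure Θ} [SFinite νA] [SFinite νΘ]
    (P : Measure Ω) (gA : CondDensity A νA) (PA : CondDensity (Ω × D × A) νΘ)
    (UA : Ω → A × Θ → ℝ) (hUA : Measurable (Function.uncurry UA)) (d : D) (a₀ : A) (h : ℝ)
    (K M : ℕ) : Measure A :=
  P.bind fun ω => (innerRun gA PA UA hUA ω d a₀).map fun z =>
    sampleMode νA h K M fun i => (z i).1

/-! ### The Defender's problem -/

/-- `p_D(a | d) = P (A*(d) = a)`, that is, `p_D(· | d)` is the law of the random optimal attack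
`A*(d)`, as a Markov kernel in `d`. -/
def attackDist (P : Measure Ω) [SFinite P] (Astar : D → Ω → A)
    (hA : Measurable (Function.uncurry Astar)) : Kernel D A where
  toFun d := P.map (Astar d)
  measurable' := by
    have h : (fun d => P.map (Astar d)) =
        fun d => (P.map (Prod.mk d)).map (Function.uncurry Astar) := by
      funext d
      rw [Measure.map_map hA measurable_prodMk_left]
      rfl
    rw [h]
    exact (Measure.measurable_map _ hA).comp Measurable.map_prodMk_left

instance (P : Measure Ω) [IsProbabilityMeasure P] (Astar : D → Ω → A)
    (hA : Measurable (Function.uncurry Astar)) : IsMarkovKernel (attackDist P Astar hA) :=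
  ⟨fun _ => Measure.isProbabilityMeasure_map (hA.comp measurable_prodMk_left).aemeasurable⟩

/-- Expected utility of the defense `d` if attacks have the distribution `q (a | d)`:
`ψ_D(d) = ∫∫ u_D(d,θ) p_D(θ | d,a) q(a | d) da dθ`. -/
def defenderExpectedUtility {νΘ : Measure Θ} (uD : D × Θ → ℝ) (pD : CondDensity (D × A) νΘ)
    (q : Kernel D A) (d : D) : ℝ≥0∞ :=
  ∫⁻ a, ∫⁻ θ, ENNReal.ofReal (uD (d, θ) * pD.p (d, a) θ) ∂νΘ ∂(q d)

/-- The measure `q(a | d) dd da dθ` on the space of triples `(d, a, θ)`. -/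
def tripleMeasure (νD : Measure D) (νΘ : Measure Θ) [SFinite νΘ] (q : Kernel D A) :
    Measure (D × A × Θ) :=
  νD ⊗ₘ (q ×ₖ Kernel.const D νΘ)

/-- The Defender's augmented distribution `π_D(d,a,θ) ∝ u_D(d,θ) p_D(θ | d,a) q(a | d)`. -/
def defenderTarget (νD : Measure D) {νΘ : Measure Θ} [SFinite νΘ] (uD : D × Θ → ℝ)
    (pD : CondDensity (D × A) νΘ) (q : Kernel D A) : Measure (D × A × Θ) :=
  normalized ((tripleMeasure νD νΘ q).withDensity fun s =>
    ENNReal.ofReal (uD (s.1, s.2.2) * pD.p (s.1, s.2.1) s.2.2))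

/-! ### The nested sampler -/

/-- One iteration of the outer APS loop, on triples `(d, a, θ)`, when the attack sampler returns
for the defense `d` an attack of law `q (· | d)`: `d' ∼ g_D(· | d)`, `a' ∼ q(· | d')`,
`θ' ∼ p_D(· | d', a')`, accepted with probability `min {1, u_D(d', θ') / u_D(d, θ)}`. -/
def outerKernel {νD : Measure D} {νΘ : Measure Θ} [SFinite νD] [SFinite νΘ]
    (gD : CondDensity D νD) (pD : CondDensity (D × A) νΘ) (uD : D × Θ → ℝ) (huD : Measurable uD)
    (q : Kernel D A) [IsMarkovKernel q] : Kernel (D × A × Θ) (D × A × Θ) :=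
  apsKernel gD.kernel (q ⊗ₖ pD.kernel) (fun s => uD (s.1, s.2.2)) (huD.comp (by fun_prop))

/-- Law of the draws `(d⁽ⁱ⁾, a⁽ⁱ⁾, θ⁽ⁱ⁾)` of the outer APS loop, started from the defense `d₀`,
`a⁽⁰⁾ ∼ q(· | d₀)`, `θ⁽⁰⁾ ∼ p_D(· | d₀, a⁽⁰⁾)`. -/
def outerRun {νD : Measure D} {νΘ : Measure Θ} [SFinite νD] [SFinite νΘ]
    (gD : CondDensity D νD) (pD : CondDensity (D × A) νΘ) (uD : D × Θ → ℝ) (huD : Measurable uD)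
    (q : Kernel D A) [IsMarkovKernel q] (d₀ : D) : Measure (ℕ → D × A × Θ) :=
  apsRun gD.kernel (q ⊗ₖ pD.kernel) (fun s => uD (s.1, s.2.2)) (huD.comp (by fun_prop)) d₀

end ARA

end

/-!
For positive `u`, the augmented measure `u(x, y) ν(dx) L(x, dy)` satisfies detailed balance with the
Metropolis-Hastings kernel, because the proposal density is symmetric and the candidate `y'` is
drawn from `L x'`. This gives the stationary distributions, for both loops.

The probability that the trajectory from `s` lies in a given shift-invariant event is a harmonic
function of `s`, and by Lévy's zero-one law it is 0 or 1 for almost every `s`. Every proposal is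
accepted with positive probability, so that the set where a harmonic function attains the value 1 is
absorbing for the proposal, hence of full measure by irreducibility. Thus the stationary chain is
ergodic, and Birkhoff's theorem gives the law of large numbers. The probability of its failure is
again harmonic; it vanishes almost everywhere, hence everywhere, since proposals have a density.

The first marginal of the target has density proportional to the expected utility. Visit frequencies
converge uniformly over windows, so that for a small bandwidth the density estimates near a
well-separated maximizer eventually exceed those far from it. Bandwidths which decrease slowly
enough, chosen by a diagonal argument, then give almost sure convergence of the sample mode.
-/

noncomputable section

section Birkhoff

variable {Z : Type*}

/-- The largest of the first `n + 1` Birkhoff sums of `f` (the empty sum included), through the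
recursion on which the maximal inequality rests. -/
def maxBirkhoffSum (T : Z → Z) (f : Z → ℝ) : ℕ → Z → ℝ
  | 0, _ => 0
  | n + 1, z => max 0 (f z + maxBirkhoffSum T f n (T z))

lemma maxBirkhoffSum_nonneg (T : Z → Z) (f : Z → ℝ) (n : ℕ) (z : Z) :
    0 ≤ maxBirkhoffSum T f n z := by
  cases n with
  | zero => exact le_rfl
  | succ n => exact le_max_left _ _

lemma monotone_maxBirkhoffSum (T : Z → Z) (f : Z → ℝ) (z : Z) :
    Monotone fun n => maxBirkhoffSum T f n z := by
  refine monotone_nat_of_le_succ fun n => ?_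
  induction n generalizing z with
  | zero => exact maxBirkhoffSum_nonneg T f 1 z
  | succ n ih => exact max_le_max_left 0 (by gcongr; exact ih (T z))

lemma birkhoffSum_le_maxBirkhoffSum (T : Z → Z) (f : Z → ℝ) (n : ℕ) (z : Z) :
    birkhoffSum T f n z ≤ maxBirkhoffSum T f n z := by
  induction n generalizing z with
  | zero => exact le_rfl
  | succ n ih =>
    rw [birkhoffSum_succ']
    exact le_max_of_le_right (by gcongr; exact ih (T z))

lemma tendsto_maxBirkhoffSum_atTop {T : Z → Z} {f : Z → ℝ} {z : Z}
    (h : ¬ BddAbove (Set.range fun n => birkhoffSum T f n z)) :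
    Tendsto (fun n => maxBirkhoffSum T f n z) atTop atTop := by
  refine tendsto_atTop_atTop_of_monotone (monotone_maxBirkhoffSum T f z) fun b => ?_
  obtain ⟨_, ⟨n, rfl⟩, hn⟩ := not_bddAbove_iff.1 h b
  exact ⟨n, hn.le.trans (birkhoffSum_le_maxBirkhoffSum T f n z)⟩

lemma maxBirkhoffSum_succ_sub (T : Z → Z) (f : Z → ℝ) (n : ℕ) (z : Z) :
    maxBirkhoffSum T f (n + 1) z - maxBirkhoffSum T f n (T z) =
      max (-maxBirkhoffSum T f n (T z)) (f z) := by
  rw [maxBirkhoffSum, max_sub_sub_right _ _ _ |>.symm]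
  simp

lemma bddAbove_range_birkhoffSum_comp_iff (T : Z → Z) (f : Z → ℝ) (z : Z) :
    BddAbove (Set.range fun n => birkhoffSum T f n (T z)) ↔
      BddAbove (Set.range fun n => birkhoffSum T f n z) := by
  constructor
  · rintro ⟨b, hb⟩
    refine ⟨max 0 (f z + b), ?_⟩
    rintro _ ⟨_ | n, rfl⟩
    · exact le_max_left _ _
    · change birkhoffSum T f (n + 1) z ≤ _
      rw [birkhoffSum_succ']
      exact le_max_of_le_right (by gcongr; exact hb ⟨n, rfl⟩)
  · rintro ⟨b, hb⟩
    refine ⟨b - f z, ?_⟩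
    rintro _ ⟨n, rfl⟩
    have hsucc : birkhoffSum T f (n + 1) z ≤ b := hb ⟨n + 1, rfl⟩
    rw [birkhoffSum_succ'] at hsucc
    exact le_sub_iff_add_le'.2 hsucc

lemma tendsto_birkhoffAverage_comp_iff (T : Z → Z) (f : Z → ℝ) (z : Z) (c : ℝ) :
    Tendsto (fun n => birkhoffAverage ℝ T f n (T z)) atTop (𝓝 c) ↔
      Tendsto (fun n => birkhoffAverage ℝ T f n z) atTop (𝓝 c) := by
  have hfirst : Tendsto (fun n : ℕ => f z / (n + 1 : ℕ)) atTop (𝓝 0) :=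
    (tendsto_const_div_atTop_nhds_zero_nat _).comp (tendsto_add_atTop_nat 1)
  have hratio : Tendsto (fun n : ℕ => (n : ℝ) / (n + 1)) atTop (𝓝 1) :=
    tendsto_natCast_div_add_atTop 1
  have hsucc (n : ℕ) : birkhoffAverage ℝ T f (n + 1) z =
      f z / (n + 1 : ℕ) + n / (n + 1) * birkhoffAverage ℝ T f n (T z) := by
    rcases eq_or_ne n 0 with rfl | hn
    · simp [birkhoffAverage]
    · simp only [birkhoffAverage, birkhoffSum_succ', smul_eq_mul]
      push_cast
      field_simp
  rw [← tendsto_add_atTop_iff_nat (f := fun n => birkhoffAverage ℝ T f n z) 1]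
  simp only [hsucc]
  constructor
  · intro h
    simpa using hfirst.add (hratio.mul h)
  · intro h
    have hdiv := (h.sub hfirst).div hratio one_ne_zero
    simp only [add_sub_cancel_left, sub_zero, div_one] at hdiv
    refine hdiv.congr' ?_
    filter_upwards [eventually_ne_atTop 0] with n hn
    rw [Pi.div_apply]
    field_simp

variable [MeasurableSpace Z] {μ : Measure Z} {T : Z → Z} {f : Z → ℝ}

lemma integrable_maxBirkhoffSum (hT : MeasurePreserving T μ μ) (hf : Integrable f μ) (n : ℕ) :
    Integrable (maxBirkhoffSum T f n) μ := by
  induction n with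
  | zero => exact integrable_zero _ _ _
  | succ n ih => exact (integrable_zero _ _ _).sup (hf.add (hT.integrable_comp_of_integrable ih))

theorem integral_nonneg_of_ae_not_bddAbove_birkhoffSum (hT : MeasurePreserving T μ μ)
    (hf : Integrable f μ)
    (h : ∀ᵐ z ∂μ, ¬ BddAbove (Set.range fun n => birkhoffSum T f n z)) : 0 ≤ ∫ z, f z ∂μ := by
  let gain (n : ℕ) (z : Z) : ℝ := maxBirkhoffSum T f (n + 1) z - maxBirkhoffSum T f n (T z)
  have hint := integrable_maxBirkhoffSum hT hf
  have hint_comp (n : ℕ) : Integrable (fun z => maxBirkhoffSum T f n (T z)) μ :=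
    hT.integrable_comp_of_integrable (hint n)
  have gain_nonneg (n : ℕ) : 0 ≤ ∫ z, gain n z ∂μ := by
    have hcomp : ∫ z, maxBirkhoffSum T f n (T z) ∂μ = ∫ z, maxBirkhoffSum T f n z ∂μ := by
      rw [← integral_map hT.measurable.aemeasurable (by rw [hT.map_eq]; exact (hint n).1),
        hT.map_eq]
    rw [integral_sub (hint _) (hint_comp n), hcomp, sub_nonneg]
    exact integral_mono (hint _) (hint _) fun z => monotone_maxBirkhoffSum T f z n.le_succ
  have gain_le (n : ℕ) (z : Z) : ‖gain n z‖ ≤ |f z| := by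
    have := maxBirkhoffSum_nonneg T f n (T z)
    simp only [gain, maxBirkhoffSum_succ_sub, Real.norm_eq_abs]
    grind
  have gain_lim : ∀ᵐ z ∂μ, Tendsto (fun n => gain n z) atTop (𝓝 (f z)) := by
    filter_upwards [hT.quasiMeasurePreserving.ae h] with z hz
    refine tendsto_const_nhds.congr' ?_
    filter_upwards [(tendsto_maxBirkhoffSum_atTop hz).eventually_ge_atTop (-f z)] with n hn
    simp only [gain, maxBirkhoffSum_succ_sub]
    exact (max_eq_right (by linarith)).symm
  exact ge_of_tendsto' (tendsto_integral_of_dominated_convergence _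
    (fun n => ((hint _).sub (hint_comp n)).1) hf.abs (fun n => ae_of_all _ (gain_le n)) gain_lim)
    gain_nonneg

lemma nullMeasurableSet_bddAbove_birkhoffSum (hT : Measure.QuasiMeasurePreserving T μ μ)
    (hf : AEMeasurable f μ) :
    NullMeasurableSet {z | BddAbove (Set.range fun n => birkhoffSum T f n z)} μ := by
  have hmeas (n : ℕ) : Measurable (birkhoffSum T (hf.mk f) n) :=
    Finset.measurable_sum _ fun i _ => hf.measurable_mk.comp (hT.measurable.iterate i)
  refine (measurableSet_bddAbove_range hmeas).nullMeasurableSet.congr ?_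
  have hsum := ae_all_iff.2 fun n => hT.birkhoffSum_ae_eq_of_ae_eq hf.ae_eq_mk n
  filter_upwards [hsum] with z hz
  change BddAbove _ = BddAbove _
  simp only [hz]

lemma ae_bddAbove_birkhoffSum_of_integral_neg (hT : Ergodic T μ) (hf : Integrable f μ)
    (h : ∫ z, f z ∂μ < 0) : ∀ᵐ z ∂μ, BddAbove (Set.range fun n => birkhoffSum T f n z) := by
  have hinv : T ⁻¹' {z | BddAbove (Set.range fun n => birkhoffSum T f n z)} =
      {z | BddAbove (Set.range fun n => birkhoffSum T f n z)} :=
    Set.ext (bddAbove_range_birkhoffSum_comp_iff T f)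
  refine (hT.quasiErgodic.ae_mem_or_ae_notMem₀ (nullMeasurableSet_bddAbove_birkhoffSum
    hT.quasiMeasurePreserving hf.1.aemeasurable) hinv.eventuallyEq).resolve_right fun hunbdd => ?_
  exact h.not_ge (integral_nonneg_of_ae_not_bddAbove_birkhoffSum hT.toMeasurePreserving hf hunbdd)

lemma ae_eventually_birkhoffAverage_lt [IsProbabilityMeasure μ] (hT : Ergodic T μ)
    (hf : Integrable f μ) {c : ℝ} (hc : ∫ z, f z ∂μ < c) :
    ∀ᵐ z ∂μ, ∀ᶠ n in atTop, birkhoffAverage ℝ T f n z < c := by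
  obtain ⟨b, hb, hbc⟩ := exists_between hc
  have hneg : ∫ z, (f z - b) ∂μ < 0 := by
    rw [integral_sub hf (integrable_const b)]
    simpa using hb
  filter_upwards [ae_bddAbove_birkhoffSum_of_integral_neg hT (hf.sub (integrable_const b)) hneg]
    with z ⟨C, hC⟩
  have hsum (n : ℕ) : birkhoffSum T f n z ≤ C + n * b := by
    have := hC ⟨n, rfl⟩
    simpa [birkhoffSum, sub_le_iff_le_add] using this
  have hlim : Tendsto (fun n : ℕ => C / n + b) atTop (𝓝 b) := by
    simpa using (tendsto_const_div_atTop_nhds_zero_nat C).add_const b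
  filter_upwards [hlim.eventually_lt_const hbc, eventually_gt_atTop 0] with n hn hn0
  have hn0' : (0 : ℝ) < n := Nat.cast_pos.2 hn0
  refine lt_of_le_of_lt ?_ hn
  rw [birkhoffAverage, smul_eq_mul, inv_mul_le_iff₀ hn0', mul_add, mul_div_cancel₀ _ hn0'.ne']
  exact hsum n

theorem ae_tendsto_birkhoffAverage [IsProbabilityMeasure μ] (hT : Ergodic T μ)
    (hf : Integrable f μ) :
    ∀ᵐ z ∂μ, Tendsto (fun n => birkhoffAverage ℝ T f n z) atTop (𝓝 (∫ z, f z ∂μ)) := by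
  have hupper {g : Z → ℝ} (hg : Integrable g μ) : ∀ᵐ z ∂μ, ∀ k : ℕ, ∀ᶠ n in atTop,
      birkhoffAverage ℝ T g n z < ∫ z, g z ∂μ + 1 / (k + 1) :=
    ae_all_iff.2 fun k => ae_eventually_birkhoffAverage_lt hT hg
      (lt_add_of_pos_right _ Nat.one_div_pos_of_nat)
  filter_upwards [hupper hf, hupper hf.neg] with z hf_lt hneg_lt
  rw [Metric.tendsto_nhds]
  intro ε hε
  obtain ⟨k, hk⟩ := exists_nat_one_div_lt hε
  filter_upwards [hf_lt k, hneg_lt k] with n hn hn'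
  simp only [birkhoffAverage_neg, Pi.neg_apply, integral_neg] at hn'
  rw [Real.dist_eq, abs_sub_lt_iff]
  constructor <;> linarith

end Birkhoff

section MarkovChain

variable {S : Type*}

/-- The shift by `n` steps on trajectories. -/
def shiftPath (n : ℕ) (z : ℕ → S) : ℕ → S := fun i => z (n + i)

variable [MeasurableSpace S]

/-- The natural filtration of the coordinate process on trajectories. -/
abbrev pathFiltration (S : Type*) [MeasurableSpace S] :
    Filtration ℕ (MeasurableSpace.pi : MeasurableSpace (ℕ → S)) :=
  Filtration.piLE (X := fun _ : ℕ => S)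

/-- `m` is the law of a homogeneous Markov chain with transition kernel `κ`, up to its total mass:
whatever the past up to the time `n`, the next state is drawn from `κ (z n)`. -/
def IsMarkovChain (m : Measure (ℕ → S)) (κ : Kernel S S) : Prop :=
  ∀ (n : ℕ) (E : Set (ℕ → S)), MeasurableSet[pathFiltration S n] E →
    ∀ B : Set S, MeasurableSet B → m (E ∩ {z | z (n + 1) ∈ B}) = ∫⁻ z in E, κ (z n) B ∂m

@[fun_prop]
lemma measurable_shiftPath (n : ℕ) : Measurable (shiftPath (S := S) n) :=
  measurable_pi_lambda _ fun _ => measurable_pi_apply _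

lemma measurable_pathFiltration_iff {Z : Type*} {mZ : MeasurableSpace Z} {f : Z → ℕ → S} {n : ℕ} :
    Measurable[mZ, pathFiltration S n] f ↔ ∀ i ≤ n, Measurable fun x => f x i := by
  rw [Filtration.piLE_eq_comap_frestrictLe, measurable_comap_iff, measurable_pi_iff]
  exact ⟨fun h i hi => h ⟨i, Finset.mem_Iic.2 hi⟩, fun h i => h i (Finset.mem_Iic.1 i.2)⟩

lemma measurable_pathFiltration_eval {n i : ℕ} (h : i ≤ n) :
    Measurable[pathFiltration S n] fun z : ℕ → S => z i :=
  measurable_pathFiltration_iff.1 (@measurable_id _ (pathFiltration S n)) i h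

lemma measurable_pathFiltration_shiftPath (n k : ℕ) :
    Measurable[pathFiltration S (n + k), pathFiltration S k] (shiftPath n) :=
  measurable_pathFiltration_iff.2 fun _ hi =>
    measurable_pathFiltration_eval (Nat.add_le_add_left hi n)

lemma iSup_pathFiltration : ⨆ n, pathFiltration S n = MeasurableSpace.pi := by
  refine le_antisymm (iSup_le fun n => (pathFiltration S).le n) ?_
  exact iSup_le fun n => ((measurable_pathFiltration_eval le_rfl).comap_le).trans
    (le_iSup (fun n => (pathFiltration S n : MeasurableSpace (ℕ → S))) n)

lemma pathFiltration_succ_le (n : ℕ) :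
    pathFiltration S (n + 1) ≤ MeasurableSpace.comap
      (fun z : ℕ → S => (Preorder.frestrictLe (π := fun _ => S) n z, z (n + 1))) inferInstance := by
  let pair : (ℕ → S) → (Finset.Iic n → S) × S := fun z => (Preorder.frestrictLe n z, z (n + 1))
  have hpair : Measurable[MeasurableSpace.comap pair inferInstance] pair := comap_measurable pair
  have hid : Measurable[MeasurableSpace.comap pair inferInstance, pathFiltration S (n + 1)] id := by
    refine measurable_pathFiltration_iff.2 fun i hi => ?_
    rcases hi.lt_or_eq with h | rfl
    · exact ((measurable_pi_apply ⟨i, Finset.mem_Iic.2 (Nat.lt_succ_iff.1 h)⟩).comp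
        measurable_fst).comp hpair
    · exact measurable_snd.comp hpair
  exact fun E hE => hid hE

lemma measure_ext_of_map_frestrictLe {m m' : Measure (ℕ → S)} [IsFiniteMeasure m]
    (h : ∀ n, m.map (Preorder.frestrictLe (π := fun _ => S) n) =
      m'.map (Preorder.frestrictLe (π := fun _ => S) n)) : m = m' := by
  have heq (n : ℕ) (E : Set (ℕ → S)) (hE : MeasurableSet[pathFiltration S n] E) : m E = m' E := by
    rw [Filtration.piLE_eq_comap_frestrictLe] at hE
    obtain ⟨C, hC, rfl⟩ := hE
    rw [← Measure.map_apply (by fun_prop) hC, h, Measure.map_apply (by fun_prop) hC]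
  refine ext_of_generate_finite _
    (iSup_pathFiltration.symm.trans (MeasurableSpace.measurableSpace_iSup_eq _)) ?_ ?_
    (heq 0 _ .univ)
  · rw [Set.ofPred_exists]
    exact isPiSystem_iUnion_of_monotone _
      (fun n => @MeasurableSpace.isPiSystem_measurableSet _ (pathFiltration S n))
      fun _ _ hij => (pathFiltration S).mono hij
  · rintro E ⟨n, hE⟩
    exact heq n E hE

namespace IsMarkovChain

variable {κ : Kernel S S} {m m' : Measure (ℕ → S)}

lemma map_prodMk_eq [IsFiniteMeasure m] (hm : IsMarkovChain m κ) (hm' : IsMarkovChain m' κ) {n : ℕ}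
    (h : m.map (Preorder.frestrictLe (π := fun _ => S) n) =
      m'.map (Preorder.frestrictLe (π := fun _ => S) n)) :
    m.map (fun z => (Preorder.frestrictLe (π := fun _ => S) n z, z (n + 1))) =
      m'.map (fun z => (Preorder.frestrictLe (π := fun _ => S) n z, z (n + 1))) := by
  have hrect {m : Measure (ℕ → S)} (hm : IsMarkovChain m κ) {C : Set (Finset.Iic n → S)}
      (hC : MeasurableSet C) {B : Set S} (hB : MeasurableSet B) :
      m.map (fun z => (Preorder.frestrictLe (π := fun _ => S) n z, z (n + 1))) (C ×ˢ B) =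
        ∫⁻ y in C, κ (y ⟨n, by simp⟩) B ∂m.map (Preorder.frestrictLe (π := fun _ => S) n) := by
    have hκ : Measurable fun y : Finset.Iic n → S => κ (y ⟨n, by simp⟩) B :=
      (κ.measurable_coe hB).comp (measurable_pi_apply _)
    rw [Measure.map_apply (by fun_prop) (hC.prod hB), setLIntegral_map hC hκ (by fun_prop)]
    refine hm n _ ?_ B hB
    rw [Filtration.piLE_eq_comap_frestrictLe]
    exact ⟨C, hC, rfl⟩
  exact Measure.ext_prod fun hC hB => by rw [hrect hm hC hB, hrect hm' hC hB, h]

theorem ext [IsFiniteMeasure m] (hm : IsMarkovChain m κ) (hm' : IsMarkovChain m' κ)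
    (h0 : m.map (fun z => z 0) = m'.map (fun z => z 0)) : m = m' := by
  refine measure_ext_of_map_frestrictLe fun n => ?_
  induction n with
  | zero =>
    have : Preorder.frestrictLe (π := fun _ => S) 0 =
        (fun s _ => s) ∘ (fun z : ℕ → S => z 0) := by
      ext z ⟨i, hi⟩
      obtain rfl : i = 0 := by simpa using hi
      rfl
    rw [this, ← Measure.map_map (by fun_prop) (by fun_prop), h0,
      Measure.map_map (by fun_prop) (by fun_prop)]
  | succ n ih =>
    refine Measure.ext fun C hC => ?_
    have hC' : MeasurableSet[pathFiltration S (n + 1)] (Preorder.frestrictLe (n + 1) ⁻¹' C) := by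
      rw [Filtration.piLE_eq_comap_frestrictLe]
      exact ⟨C, hC, rfl⟩
    obtain ⟨R, hR, hRC⟩ := pathFiltration_succ_le n _ hC'
    rw [Measure.map_apply (by fun_prop) hC, Measure.map_apply (by fun_prop) hC, ← hRC,
      ← Measure.map_apply (by fun_prop) hR, ← Measure.map_apply (by fun_prop) hR,
      hm.map_prodMk_eq hm' ih]

lemma bind (μ : Measure S) {R : Kernel S (ℕ → S)} (hR : ∀ s, IsMarkovChain (R s) κ) :
    IsMarkovChain (μ.bind R) κ := by
  intro n E hE B hB
  have hE' : MeasurableSet E := (pathFiltration S).le n E hE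
  have hκ : Measurable fun z : ℕ → S => κ (z n) B :=
    (κ.measurable_coe hB).comp (measurable_pi_apply n)
  have hEB : MeasurableSet (E ∩ {z | z (n + 1) ∈ B}) :=
    hE'.inter (hB.preimage (measurable_pi_apply (n + 1)))
  rw [Measure.bind_apply hEB R.aemeasurable,
    ← lintegral_indicator hE', Measure.lintegral_bind R.aemeasurable
      (hκ.indicator hE').aemeasurable]
  exact lintegral_congr fun s => by rw [hR s n E hE B hB, lintegral_indicator hE']

theorem map_shiftPath_restrict (hm : IsMarkovChain m κ) (n : ℕ) {E : Set (ℕ → S)}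
    (hE : MeasurableSet[pathFiltration S n] E) :
    IsMarkovChain ((m.restrict E).map (shiftPath n)) κ := by
  intro k F hF B hB
  have hF' : MeasurableSet F := (pathFiltration S).le k F hF
  have hκ : Measurable fun z : ℕ → S => κ (z k) B :=
    (κ.measurable_coe hB).comp (measurable_pi_apply k)
  have hFB : MeasurableSet (F ∩ {z | z (k + 1) ∈ B}) :=
    hF'.inter (hB.preimage (measurable_pi_apply (k + 1)))
  rw [Measure.map_apply (by fun_prop) hFB, Measure.restrict_apply (hFB.preimage (by fun_prop)),
    setLIntegral_map hF' hκ (by fun_prop), Measure.restrict_restrict (hF'.preimage (by fun_prop)),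
    Set.preimage_inter, Set.inter_right_comm]
  exact hm (n + k) _ ((measurable_pathFiltration_shiftPath n k hF).inter
    ((pathFiltration S).mono (Nat.le_add_right n k) E hE)) B hB

end IsMarkovChain

section PathKernel

/-- The law of the trajectory of the Markov chain with transition kernel `κ`, as a kernel in the
starting point. -/
def pathKernel (κ : Kernel S S) [IsMarkovKernel κ] : Kernel S (ℕ → S) :=
  (Kernel.traj (X := fun _ => S) (fun n =>
    κ.comap (fun x : (i : Finset.Iic n) → S => x ⟨n, Finset.mem_Iic.2 le_rfl⟩)
      (measurable_pi_apply _)) 0).comap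
    (MeasurableEquiv.piUnique (fun _ : Finset.Iic 0 => S)).symm (MeasurableEquiv.measurable _)

variable (μ : Measure S) (κ : Kernel S S) [IsMarkovKernel κ]

instance : IsMarkovKernel (pathKernel κ) := by
  unfold pathKernel; infer_instance

lemma chainLaw_eq_bind : chainLaw μ κ = μ.bind (pathKernel κ) := by
  refine Measure.ext fun E hE => ?_
  unfold chainLaw Kernel.trajMeasure pathKernel
  rw [Measure.bind_apply hE (Kernel.aemeasurable _), Measure.bind_apply hE (Kernel.aemeasurable _),
    lintegral_map (Kernel.measurable_coe _ hE) (MeasurableEquiv.measurable _)]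
  rfl

lemma chainLaw_apply {E : Set (ℕ → S)} (hE : MeasurableSet E) :
    chainLaw μ κ E = ∫⁻ s, pathKernel κ s E ∂μ := by
  rw [chainLaw_eq_bind, Measure.bind_apply hE (Kernel.aemeasurable _)]

instance [IsProbabilityMeasure μ] : IsProbabilityMeasure (chainLaw μ κ) := by
  rw [chainLaw_eq_bind]; infer_instance

lemma chainLaw_dirac (s : S) : chainLaw (Measure.dirac s) κ = pathKernel κ s := by
  rw [chainLaw_eq_bind, Measure.dirac_bind (Kernel.measurable _)]

lemma isMarkovChain_pathKernel (s : S) : IsMarkovChain (pathKernel κ s) κ := by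
  intro n E hE B hB
  rw [Filtration.piLE_eq_comap_frestrictLe] at hE
  obtain ⟨C, hC, rfl⟩ := hE
  have hstep := Kernel.map_frestrictLe_trajMeasure_compProd_eq_map_trajMeasure
    (X := fun _ => S) (μ₀ := Measure.dirac s) (κ := fun n => κ.comap
      (fun x : (i : Finset.Iic n) → S => x ⟨n, Finset.mem_Iic.2 le_rfl⟩)
      (measurable_pi_apply _)) (a := n)
  have hrect := congrArg (fun m => m (C ×ˢ B)) hstep
  beta_reduce at hrect
  rw [Measure.compProd_apply_prod hC hB, Measure.map_apply (by fun_prop) (hC.prod hB),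
    setLIntegral_map hC (Kernel.measurable_coe _ hB) (by fun_prop)] at hrect
  rw [← chainLaw_dirac]
  exact hrect.symm

lemma isMarkovChain_chainLaw : IsMarkovChain (chainLaw μ κ) κ := by
  rw [chainLaw_eq_bind]
  exact .bind μ (isMarkovChain_pathKernel κ)

lemma map_zero_pathKernel (s : S) : (pathKernel κ s).map (fun z => z 0) = Measure.dirac s := by
  have h : (fun z : ℕ → S => z 0) = (fun y : Finset.Iic 0 → S => y ⟨0, by simp⟩) ∘
    Preorder.frestrictLe (π := fun _ => S) 0 := rfl
  rw [h, ← Measure.map_map (by fun_prop) (by fun_prop)]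
  unfold pathKernel
  rw [Kernel.comap_apply, Kernel.traj_map_frestrictLe_apply, Kernel.partialTraj_self,
    Kernel.id_apply, Measure.map_dirac' (by fun_prop)]
  rfl

lemma map_zero_chainLaw : (chainLaw μ κ).map (fun z => z 0) = μ := by
  refine Measure.ext fun B hB => ?_
  have h0 : Measurable fun z : ℕ → S => z 0 := measurable_pi_apply 0
  rw [Measure.map_apply h0 hB, chainLaw_apply μ κ (h0 hB), ← lintegral_indicator_one hB]
  refine lintegral_congr fun s => ?_
  rw [← Measure.map_apply h0 hB, map_zero_pathKernel, Measure.dirac_apply' _ hB]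

variable {μ κ} {m : Measure (ℕ → S)} [IsFiniteMeasure m]

lemma IsMarkovChain.eq_chainLaw (hm : IsMarkovChain m κ) :
    m = chainLaw (m.map fun z => z 0) κ :=
  hm.ext (isMarkovChain_chainLaw _ κ) (map_zero_chainLaw _ κ).symm

theorem IsMarkovChain.measure_inter_preimage_shiftPath (hm : IsMarkovChain m κ) (n : ℕ)
    {E : Set (ℕ → S)} (hE : MeasurableSet[pathFiltration S n] E) {F : Set (ℕ → S)}
    (hF : MeasurableSet F) :
    m (shiftPath n ⁻¹' F ∩ E) = ∫⁻ z in E, pathKernel κ (z n) F ∂m := by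
  rw [← Measure.restrict_apply (hF.preimage (by fun_prop)), ← Measure.map_apply (by fun_prop) hF,
    (hm.map_shiftPath_restrict n hE).eq_chainLaw, chainLaw_apply _ _ hF,
    Measure.map_map (by fun_prop) (by fun_prop),
    lintegral_map (Kernel.measurable_coe _ hF) (by fun_prop)]
  rfl

theorem chainLaw_map_shiftPath_one (μ : Measure S) [IsFiniteMeasure μ] :
    (chainLaw μ κ).map (shiftPath 1) = chainLaw (μ.bind κ) κ := by
  have : IsFiniteMeasure (chainLaw μ κ) := by rw [chainLaw_eq_bind]; infer_instance
  have hshift := (isMarkovChain_chainLaw μ κ).map_shiftPath_restrict 1 .univ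
  rw [Measure.restrict_univ] at hshift
  refine hshift.ext (isMarkovChain_chainLaw _ κ) ?_
  rw [map_zero_chainLaw, Measure.map_map (by fun_prop) (by fun_prop)]
  refine Measure.ext fun B hB => ?_
  have hstep := isMarkovChain_chainLaw μ κ 0 Set.univ .univ B hB
  rw [Measure.restrict_univ, Set.univ_inter,
    ← lintegral_map (f := fun s => κ s B) (κ.measurable_coe hB) (measurable_pi_apply 0),
    map_zero_chainLaw] at hstep
  rw [Measure.map_apply (by fun_prop) hB, Measure.bind_apply hB κ.aemeasurable, ← hstep]
  rfl

end PathKernel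

end MarkovChain

section ErgodicChain

lemma iterate_shiftPath_one {S : Type*} (n : ℕ) : (shiftPath (S := S) 1)^[n] = shiftPath n := by
  induction n with
  | zero => exact funext fun z => funext fun i => congrArg z (zero_add i).symm
  | succ n ih =>
    rw [Function.iterate_succ', ih]
    exact funext fun z => funext fun i => congrArg z (add_assoc n 1 i).symm

lemma preimage_shiftPath_eq {S : Type*} {E : Set (ℕ → S)} (hE : shiftPath 1 ⁻¹' E = E) (n : ℕ) :
    shiftPath n ⁻¹' E = E := by
  rw [← iterate_shiftPath_one, Set.preimage_iterate_eq]
  exact Function.iterate_fixed hE n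

variable {S : Type*} [MeasurableSpace S] {κ : Kernel S S} [IsMarkovKernel κ]

lemma IsMarkovChain.condExp_indicator {m : Measure (ℕ → S)} [IsProbabilityMeasure m]
    (hm : IsMarkovChain m κ) {E : Set (ℕ → S)} (hE : MeasurableSet E)
    (hinv : shiftPath 1 ⁻¹' E = E) (n : ℕ) :
    m[E.indicator (1 : (ℕ → S) → ℝ) | pathFiltration S n] =ᵐ[m]
      fun z => (pathKernel κ (z n)).real E := by
  have hP : Measurable fun s => (pathKernel κ s).real E :=
    (Kernel.measurable_coe _ hE).ennreal_toReal
  have hint : Integrable (fun z : ℕ → S => (pathKernel κ (z n)).real E) m :=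
    .of_bound (hP.comp (measurable_pi_apply n)).aestronglyMeasurable 1 <| ae_of_all _ fun z => by
      rw [Real.norm_of_nonneg measureReal_nonneg]; exact measureReal_le_one
  refine (ae_eq_condExp_of_forall_setIntegral_eq ((pathFiltration S).le n)
    ((integrable_const (1 : ℝ)).indicator hE) (fun _ _ _ => hint.integrableOn) ?_ ?_).symm
  · intro F hF _
    have hmarkov := hm.measure_inter_preimage_shiftPath n hF hE
    rw [preimage_shiftPath_eq hinv] at hmarkov
    have hset : ∫ z in F, E.indicator (1 : (ℕ → S) → ℝ) z ∂m = (m (E ∩ F)).toReal := by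
      rw [integral_indicator_one hE, measureReal_def, Measure.restrict_apply hE]
    refine Eq.trans ?_ hset.symm
    rw [hmarkov, ← integral_toReal]
    · rfl
    · exact ((Kernel.measurable_coe _ hE).comp (measurable_pi_apply n)).aemeasurable
    · exact ae_of_all _ fun z => measure_lt_top _ _
  · exact (hP.comp (measurable_pathFiltration_eval le_rfl)).stronglyMeasurable.aestronglyMeasurable

theorem IsMarkovChain.ae_tendsto_pathKernel {m : Measure (ℕ → S)} [IsProbabilityMeasure m]
    (hm : IsMarkovChain m κ) {E : Set (ℕ → S)} (hE : MeasurableSet E)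
    (hinv : shiftPath 1 ⁻¹' E = E) :
    ∀ᵐ z ∂m, Tendsto (fun n => pathKernel κ (z n) E) atTop (𝓝 (E.indicator 1 z)) := by
  have hmeas : StronglyMeasurable[⨆ n, pathFiltration S n] (E.indicator (1 : (ℕ → S) → ℝ)) := by
    rw [iSup_pathFiltration]
    exact (measurable_one.indicator hE).stronglyMeasurable
  have hint : Integrable (E.indicator (1 : (ℕ → S) → ℝ)) m :=
    (integrable_const (1 : ℝ)).indicator hE
  filter_upwards [hint.tendsto_ae_condExp hmeas, ae_all_iff.2 (hm.condExp_indicator hE hinv)]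
    with z hlim hcond
  simp only [hcond] at hlim
  rw [← ENNReal.tendsto_toReal_iff (fun n => measure_ne_top _ _)
    (by by_cases hz : z ∈ E <;> simp [hz])]
  by_cases hz : z ∈ E <;> simpa [hz, measureReal_def] using hlim

/-- A measurable function with values in `[0, 1]` which is constant in mean along the chain with
transition kernel `κ`; the bound is part of the notion because the functions used here are
probabilities. -/
structure IsHarmonic (κ : Kernel S S) (f : S → ℝ≥0∞) : Prop where
  measurable : Measurable f
  le_one : ∀ s, f s ≤ 1
  eq_lintegral : ∀ s, f s = ∫⁻ t, f t ∂κ s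

lemma isHarmonic_pathKernel {E : Set (ℕ → S)} (hE : MeasurableSet E)
    (hinv : shiftPath 1 ⁻¹' E = E) : IsHarmonic κ fun s => pathKernel κ s E where
  measurable := Kernel.measurable_coe _ hE
  le_one _ := prob_le_one
  eq_lintegral s := by
    rw [← chainLaw_apply _ _ hE]
    nth_rw 1 [← hinv]
    rw [← Measure.map_apply (by fun_prop) hE, ← chainLaw_dirac, chainLaw_map_shiftPath_one,
      Measure.dirac_bind κ.measurable]

section Stationary

variable {π : Measure S} [IsProbabilityMeasure π] (hπ : κ.Invariant π)
include hπ

lemma measurePreserving_shiftPath :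
    MeasurePreserving (shiftPath 1) (chainLaw π κ) (chainLaw π κ) :=
  ⟨by fun_prop, by rw [chainLaw_map_shiftPath_one, hπ.def]⟩

lemma chainLaw_map_eval (n : ℕ) : (chainLaw π κ).map (fun z => z n) = π := by
  have hshift := ((measurePreserving_shiftPath hπ).iterate n).map_eq
  rw [iterate_shiftPath_one] at hshift
  rw [← map_zero_chainLaw π κ]
  nth_rw 2 [← hshift]
  rw [Measure.map_map (by fun_prop) (by fun_prop), map_zero_chainLaw]
  rfl

lemma ae_pathKernel_eq_zero_or_one {E : Set (ℕ → S)} (hE : MeasurableSet E)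
    (hinv : shiftPath 1 ⁻¹' E = E) :
    ∀ᵐ s ∂π, pathKernel κ s E = 0 ∨ pathKernel κ s E = 1 := by
  let v (s : S) : ℝ≥0∞ := pathKernel κ s E * (1 - pathKernel κ s E)
  have hP : Measurable fun s => pathKernel κ s E := Kernel.measurable_coe _ hE
  have hv : Measurable v := hP.mul (measurable_const.sub hP)
  have hstat (n : ℕ) : ∫⁻ z, v (z n) ∂chainLaw π κ = ∫⁻ s, v s ∂π := by
    rw [← lintegral_map hv (measurable_pi_apply n), chainLaw_map_eval hπ]
  have hlim : Tendsto (fun n => ∫⁻ z, v (z n) ∂chainLaw π κ) atTop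
      (𝓝 (∫⁻ _, 0 ∂chainLaw π κ)) := by
    refine tendsto_lintegral_of_dominated_convergence 1 (fun n => hv.comp (measurable_pi_apply n))
      (fun n => ae_of_all _ fun z => mul_le_one' prob_le_one tsub_le_self) (by simp) ?_
    filter_upwards [(isMarkovChain_chainLaw π κ).ae_tendsto_pathKernel hE hinv] with z hz
    have hsub := ENNReal.Tendsto.sub tendsto_const_nhds hz (.inl ENNReal.one_ne_top)
    have hmul := ENNReal.Tendsto.mul hz (.inr ((tsub_le_self.trans_lt ENNReal.one_lt_top).ne))
      hsub (.inr (by by_cases hzE : z ∈ E <;> simp [hzE]))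
    by_cases hzE : z ∈ E <;> simpa [hzE] using hmul
  simp only [hstat, lintegral_zero] at hlim
  filter_upwards [(lintegral_eq_zero_iff hv).1 (tendsto_nhds_unique tendsto_const_nhds hlim)]
    with s hs
  exact (mul_eq_zero.1 hs).imp_right fun h => le_antisymm prob_le_one (tsub_eq_zero_iff_le.1 h)

theorem ergodic_shiftPath
    (hmax : ∀ f, IsHarmonic κ f → (∃ s, f s = 1) → ∀ᵐ s ∂π, f s = 1) :
    Ergodic (shiftPath 1) (chainLaw π κ) := by
  refine { measurePreserving_shiftPath hπ with aeconst_set := fun E hE hinv => ?_ }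
  rw [Filter.eventuallyConst_set]
  by_cases hex : ∃ s, pathKernel κ s E = 1
  · refine .inl ((mem_ae_iff_prob_eq_one hE).2 ?_)
    rw [chainLaw_apply _ _ hE, lintegral_congr_ae (hmax _ (isHarmonic_pathKernel hE hinv) hex)]
    simp
  · refine .inr (measure_eq_zero_iff_ae_notMem.1 ?_)
    rw [chainLaw_apply _ _ hE, lintegral_eq_zero_iff (Kernel.measurable_coe _ hE)]
    filter_upwards [ae_pathKernel_eq_zero_or_one hπ hE hinv] with s hs
    exact hs.resolve_right fun h => hex ⟨s, h⟩

theorem ae_tendsto_birkhoffAverage_chainLaw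
    (hmax : ∀ f, IsHarmonic κ f → (∃ s, f s = 1) → ∀ᵐ s ∂π, f s = 1)
    (hzero : ∀ f, IsHarmonic κ f → (∀ᵐ s ∂π, f s = 0) → ∀ s, f s = 0)
    (μ : Measure S) {f : S → ℝ} (hf : Measurable f) (hint : Integrable f π) :
    ∀ᵐ z ∂chainLaw μ κ,
      Tendsto (fun n => birkhoffAverage ℝ (shiftPath 1) (fun z => f (z 0)) n z) atTop
        (𝓝 (∫ s, f s ∂π)) := by
  let f₀ (z : ℕ → S) : ℝ := f (z 0)
  have hf₀ : Measurable f₀ := hf.comp (measurable_pi_apply 0)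
  let E : Set (ℕ → S) :=
    {z | ¬ Tendsto (fun n => birkhoffAverage ℝ (shiftPath 1) f₀ n z) atTop (𝓝 (∫ s, f s ∂π))}
  have hE : MeasurableSet E := by
    have hsum (n : ℕ) : Measurable fun z => birkhoffSum (shiftPath 1) f₀ n z :=
      Finset.measurable_sum _ fun i _ => hf₀.comp ((measurable_shiftPath 1).iterate i)
    exact (measurableSet_tendsto _ fun n => (hsum n).const_smul (n : ℝ)⁻¹).compl
  have hinv : shiftPath 1 ⁻¹' E = E :=
    Set.ext fun z => not_congr (tendsto_birkhoffAverage_comp_iff _ _ _ _)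
  have hintegral : ∫ z, f₀ z ∂chainLaw π κ = ∫ s, f s ∂π := by
    nth_rw 2 [← chainLaw_map_eval hπ 0]
    exact (integral_map (measurable_pi_apply 0).aemeasurable hf.aestronglyMeasurable).symm
  have hint₀ : Integrable f₀ (chainLaw π κ) := by
    rw [← chainLaw_map_eval hπ 0] at hint
    exact hint.comp_measurable (measurable_pi_apply 0)
  have hstat : chainLaw π κ E = 0 := by
    have := ae_tendsto_birkhoffAverage (ergodic_shiftPath hπ hmax) hint₀
    rwa [hintegral] at this
  rw [chainLaw_apply _ _ hE, lintegral_eq_zero_iff (Kernel.measurable_coe _ hE)] at hstat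
  have hnull : chainLaw μ κ E = 0 := by
    rw [chainLaw_apply _ _ hE]
    simp [hzero _ (isHarmonic_pathKernel hE hinv) hstat]
  exact hnull

end Stationary

/-- The number of visits of `z (K + 1), …, z M` to `B`, divided by `M` (rather than by `M - K`,
which makes no difference in the limit). -/
def visitFreq {X : Type*} (B : Set X) (K M : ℕ) (z : ℕ → X) : ℝ :=
  open Classical in (((Finset.Ioc K M).filter fun j => z j ∈ B).card : ℝ) / M

lemma visitFreq_eq_birkhoffSum_sub {X : Type*} (B : Set X) {K M : ℕ} (hKM : K ≤ M) (z : ℕ → X) :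
    visitFreq B K M z =
      (birkhoffSum (shiftPath 1) (fun z => B.indicator (1 : X → ℝ) (z 0)) (M + 1) z -
        birkhoffSum (shiftPath 1) (fun z => B.indicator (1 : X → ℝ) (z 0)) (K + 1) z) / M := by
  classical
  have hsum (n : ℕ) : birkhoffSum (shiftPath 1) (fun z => B.indicator (1 : X → ℝ) (z 0)) n z =
      ∑ j ∈ Finset.range n, B.indicator 1 (z j) := by
    simp only [birkhoffSum, iterate_shiftPath_one]
    rfl
  rw [hsum, hsum, ← Finset.sum_Ico_eq_sub _ (Nat.add_le_add_right hKM 1),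
    Finset.Ico_add_one_add_one_eq_Ioc, visitFreq, Finset.card_filter]
  push_cast
  rfl

lemma tendsto_visitFreq {X : Type*} {B : Set X} {z : ℕ → X} {p : ℝ} (K : ℕ)
    (h : Tendsto (fun n => birkhoffAverage ℝ (shiftPath 1)
      (fun z => B.indicator (1 : X → ℝ) (z 0)) n z) atTop (𝓝 p)) :
    Tendsto (fun M => visitFreq B K M z) atTop (𝓝 p) := by
  let f (z : ℕ → X) : ℝ := B.indicator 1 (z 0)
  have hratio : Tendsto (fun M : ℕ => ((M + 1 : ℕ) : ℝ) / M) atTop (𝓝 1) := by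
    simpa using (tendsto_natCast_div_add_atTop (1 : ℝ)).inv₀ one_ne_zero
  have hlim : Tendsto (fun M : ℕ => ((M + 1 : ℕ) : ℝ) / M *
      birkhoffAverage ℝ (shiftPath 1) f (M + 1) z - birkhoffSum (shiftPath 1) f (K + 1) z / M)
      atTop (𝓝 p) := by
    simpa using (hratio.mul ((tendsto_add_atTop_iff_nat 1).2 h)).sub
      (tendsto_const_div_atTop_nhds_zero_nat _)
  refine hlim.congr' ?_
  filter_upwards [eventually_ge_atTop K] with M hM
  rw [visitFreq_eq_birkhoffSum_sub B hM, sub_div, birkhoffAverage, smul_eq_mul, div_mul_eq_mul_div,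
    mul_inv_cancel_left₀ (by positivity)]

end ErgodicChain

section MetropolisHastings

variable {S : Type*} [MeasurableSpace S]

lemma IsHarmonic.ae_eq_one {κ : Kernel S S} [IsMarkovKernel κ] {f : S → ℝ≥0∞}
    (hf : IsHarmonic κ f) {s : S} (hs : f s = 1) : ∀ᵐ t ∂κ s, f t = 1 := by
  have hmean : ∫⁻ t, f t ∂κ s = 1 := by rw [← hf.eq_lintegral, hs]
  have hdefect : ∫⁻ t, (1 - f t) ∂κ s = 0 := by
    rw [lintegral_sub hf.measurable (by simp [hmean]) (ae_of_all _ hf.le_one), hmean]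
    simp
  filter_upwards [(lintegral_eq_zero_iff (measurable_const.sub hf.measurable)).1 hdefect] with t ht
  exact le_antisymm (hf.le_one t) (tsub_eq_zero_iff_le.1 ht)

lemma measure_compl_eq_zero_of_absorbing {φ : Measure S} {κ : Kernel S S}
    (hirr : Kernel.IsIrreducible φ κ) {T : Set S} (hT : MeasurableSet T) (hne : T.Nonempty)
    (habs : ∀ x ∈ T, κ x Tᶜ = 0) : φ Tᶜ = 0 := by
  have hpow (n : ℕ) : ∀ x ∈ T, (κ ^ n) x Tᶜ = 0 := by
    induction n with
    | zero =>
      intro x hx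
      rw [pow_zero]
      change Measure.dirac x Tᶜ = 0
      simp [Measure.dirac_apply' _ hT.compl, hx]
    | succ n ih =>
      intro x hx
      rw [Kernel.pow_succ_apply_eq_lintegral _ _ _ hT.compl,
        lintegral_eq_zero_iff (Kernel.measurable_coe _ hT.compl)]
      filter_upwards [measure_eq_zero_iff_ae_notMem.1 (ih x hx)] with y hy
      exact habs y (not_not.1 hy)
  obtain ⟨x, hx⟩ := hne
  by_contra hφ
  obtain ⟨n, hn⟩ := hirr.irreducible hT.compl (pos_iff_ne_zero.2 hφ) x
  exact hn.ne' (hpow n x hx)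

lemma isReversible_withDensity_const {m : Measure S} [SFinite m] {w : S → ℝ≥0∞}
    {k : S → S → ℝ≥0∞} (hw : Measurable w) (hk : Measurable (Function.uncurry k))
    (hbal : ∀ s t, w s * k s t = w t * k t s) :
    ((Kernel.const S m).withDensity k).IsReversible (m.withDensity w) := by
  have hks (s : S) : Measurable (k s) := hk.comp measurable_prodMk_left
  have hflow {A B : Set S} (hA : MeasurableSet A) (hB : MeasurableSet B) :
      ∫⁻ s in A, (Kernel.const S m).withDensity k s B ∂m.withDensity w =
        ∫⁻ s in A, ∫⁻ t in B, w s * k s t ∂m ∂m := by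
    rw [setLIntegral_withDensity_eq_setLIntegral_mul _ hw (Kernel.measurable_coe _ hB) hA]
    refine lintegral_congr fun s => ?_
    rw [Pi.mul_apply, Kernel.withDensity_apply' _ hk, Kernel.const_apply,
      lintegral_const_mul _ (hks s)]
  intro A B hA hB
  rw [hflow hA hB, hflow hB hA, lintegral_lintegral_swap]
  · simp only [hbal]
  · exact ((hw.comp measurable_fst).mul hk).aemeasurable

variable {Q : Kernel S S} [IsMarkovKernel Q] {α : S → S → ℝ≥0∞}
  (hα : Measurable (Function.uncurry α))
include hα

lemma measurable_rejection : Measurable fun s => ∫⁻ t, (1 - α s t) ∂Q s :=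
  Measurable.lintegral_kernel_prod_right (f := fun s t => 1 - α s t) (measurable_const.sub hα)

lemma mhKernel_apply (s : S) :
    mhKernel Q α s =
      (Q s).withDensity (α s) + (∫⁻ t, (1 - α s t) ∂Q s) • Measure.dirac s := by
  have hr : Measurable (Function.uncurry fun s (_ : S) => ∫⁻ t, (1 - α s t) ∂Q s) :=
    (measurable_rejection hα).comp measurable_fst
  rw [mhKernel, _root_.add_apply, Kernel.withDensity_apply _ hα, Kernel.withDensity_apply _ hr,
    Kernel.id_apply, withDensity_const]

lemma absolutelyContinuous_mhKernel {s : S} (hpos : ∀ t, α s t ≠ 0) :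
    Q s ≪ mhKernel Q α s := by
  rw [mhKernel_apply hα]
  exact (withDensity_absolutelyContinuous' (hα.comp measurable_prodMk_left).aemeasurable
    (ae_of_all _ hpos)).trans (Measure.le_add_right le_rfl).absolutelyContinuous

lemma IsHarmonic.eq_zero_of_mhKernel (hle : ∀ s t, α s t ≤ 1) (hpos : ∀ s t, α s t ≠ 0)
    {f : S → ℝ≥0∞} (hf : IsHarmonic (mhKernel Q α) f) {s : S} (hzero : ∀ᵐ t ∂Q s, f t = 0) :
    f s = 0 := by
  have hαs : Measurable (α s) := hα.comp measurable_prodMk_left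
  have hstay : f s = (∫⁻ t, (1 - α s t) ∂Q s) * f s := by
    nth_rw 1 [hf.eq_lintegral s]
    rw [mhKernel_apply hα, lintegral_add_measure, lintegral_smul_measure,
      lintegral_dirac' _ hf.measurable, lintegral_congr_ae
        ((withDensity_absolutelyContinuous (Q s) (α s)).ae_le hzero), lintegral_zero, zero_add,
      smul_eq_mul]
  have haccept : ∫⁻ t, α s t ∂Q s ≠ 0 := fun h => by
    obtain ⟨t, ht⟩ := ((lintegral_eq_zero_iff hαs).1 h).exists
    exact hpos s t ht
  have hreject : ∫⁻ t, (1 - α s t) ∂Q s < 1 := by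
    have hfin : ∫⁻ t, α s t ∂Q s ≠ ∞ :=
      ((lintegral_mono (hle s)).trans_lt (by simp)).ne
    rw [lintegral_sub hαs hfin (ae_of_all _ (hle s)), lintegral_one, measure_univ]
    exact ENNReal.sub_lt_self ENNReal.one_ne_top one_ne_zero haccept
  by_contra hne
  have hdecrease := (ENNReal.mul_lt_mul_iff_left hne
    (ne_top_of_le_ne_top ENNReal.one_ne_top (hf.le_one s))).2 hreject
  rw [one_mul, ← hstay] at hdecrease
  exact hdecrease.false

lemma isReversible_mhKernel {π : Measure S} (h : (Q.withDensity α).IsReversible π) :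
    (mhKernel Q α).IsReversible π := by
  have hflow (A : Set S) {B : Set S} (hB : MeasurableSet B) :
      ∫⁻ s in A, mhKernel Q α s B ∂π =
        ∫⁻ s in A, Q.withDensity α s B ∂π + ∫⁻ s in A ∩ B, ∫⁻ t, (1 - α s t) ∂Q s ∂π := by
    have hsplit (s : S) : mhKernel Q α s B =
        Q.withDensity α s B + B.indicator (fun s => ∫⁻ t, (1 - α s t) ∂Q s) s := by
      rw [mhKernel_apply hα, Kernel.withDensity_apply _ hα, Measure.add_apply, Measure.smul_apply,
        Measure.dirac_apply' _ hB]
      by_cases hs : s ∈ B <;> simp [hs]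
    simp only [hsplit]
    rw [lintegral_add_left (Kernel.measurable_coe _ hB), setLIntegral_indicator hB, Set.inter_comm]
  intro A B hA hB
  rw [hflow A hB, hflow B hA, h hA hB, Set.inter_comm]

lemma isReversible_mhKernel_of_density {m : Measure S} [SFinite m] {w : S → ℝ≥0∞}
    {q : S → S → ℝ≥0∞} (hw : Measurable w) (hq : Measurable (Function.uncurry q))
    (hQ : ∀ s, Q s = m.withDensity (q s))
    (hbal : ∀ s t, w s * (q s t * α s t) = w t * (q t s * α t s)) :
    (mhKernel Q α).IsReversible (m.withDensity w) := by
  have hdens : Q.withDensity α = (Kernel.const S m).withDensity fun s t => q s t * α s t := by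
    ext1 s
    rw [Kernel.withDensity_apply _ hα, Kernel.withDensity_apply _ (hq.mul hα), hQ,
      Kernel.const_apply]
    exact (withDensity_mul _ (hq.comp measurable_prodMk_left)
      (hα.comp measurable_prodMk_left)).symm
  refine isReversible_mhKernel hα ?_
  rw [hdens]
  exact isReversible_withDensity_const hw (hq.mul hα) hbal

end MetropolisHastings

section APS

variable {S : Type*} [MeasurableSpace S] {m : Measure S}

lemma invariant_normalized {κ : Kernel S S} (h : κ.Invariant m) :
    κ.Invariant (normalized m) := by
  rw [Kernel.Invariant, normalized, Measure.comp_smul, h.def]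

lemma isProbabilityMeasure_normalized (hzero : m ≠ 0) (htop : m Set.univ ≠ ∞) :
    IsProbabilityMeasure (normalized m) := by
  refine ⟨?_⟩
  rw [normalized, Measure.smul_apply, smul_eq_mul]
  exact ENNReal.inv_mul_cancel (by simpa using hzero) htop

variable {X Y : Type*} [MeasurableSpace X] [MeasurableSpace Y]

lemma apsProposal_apply (G : Kernel X X) [IsMarkovKernel G] (L : Kernel X Y) [IsMarkovKernel L]
    (s : X × Y) : apsProposal G L s = G s.1 ⊗ₘ L := by
  rw [apsProposal, Kernel.comap_apply, drawFrom, Measure.compProd_eq_comp_prod]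
  rfl

lemma measurable_apsAcceptance {u : X × Y → ℝ} (hu : Measurable u) :
    Measurable (Function.uncurry (apsAcceptance u)) :=
  ENNReal.measurable_ofReal.comp
    (measurable_const.min ((hu.comp measurable_snd).div (hu.comp measurable_fst)))

lemma CondDensity.kernel_apply {ν : Measure Y} [SFinite ν] (g : CondDensity X ν) (x : X) :
    g.kernel x = ν.withDensity fun y => ENNReal.ofReal (g.p x y) := by
  rw [CondDensity.kernel, Kernel.withDensity_apply _ g.measurable_ofReal, Kernel.const_apply]

/-- The unnormalized target `u (x, y) ν(dx) L(x, dy)` of the APS sampler. -/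
def apsTarget (ν : Measure X) (L : Kernel X Y) (u : X × Y → ℝ) : Measure (X × Y) :=
  (ν ⊗ₘ L).withDensity fun s => ENNReal.ofReal (u s)

section Acceptance

omit [MeasurableSpace X] [MeasurableSpace Y]
variable {u : X × Y → ℝ}

lemma apsAcceptance_le_one (s t : X × Y) : apsAcceptance u s t ≤ 1 :=
  ENNReal.ofReal_le_one.2 (min_le_left _ _)

variable (hpos : ∀ s, 0 < u s)
include hpos

lemma apsAcceptance_ne_zero (s t : X × Y) : apsAcceptance u s t ≠ 0 :=
  (ENNReal.ofReal_pos.2 (lt_min one_pos (div_pos (hpos t) (hpos s)))).ne'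

lemma ofReal_mul_apsAcceptance (s t : X × Y) :
    ENNReal.ofReal (u s) * apsAcceptance u s t = ENNReal.ofReal (min (u s) (u t)) := by
  rw [apsAcceptance, ← ENNReal.ofReal_mul (hpos s).le, mul_min_of_nonneg _ _ (hpos s).le, mul_one,
    mul_div_cancel₀ _ (hpos s).ne']

end Acceptance

variable (L : Kernel X Y) [IsMarkovKernel L] {u : X × Y → ℝ} (hu : Measurable u)

lemma ae_eq_one_of_isHarmonic_apsKernel {φ : Measure X} [SFinite φ] {G : Kernel X X}
    [IsMarkovKernel G] (hpos : ∀ s, 0 < u s) (hirr : Kernel.IsIrreducible φ G)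
    {f : X × Y → ℝ≥0∞} (hf : IsHarmonic (apsKernel G L u hu) f) (hex : ∃ s, f s = 1) :
    ∀ᵐ s ∂(φ ⊗ₘ L), f s = 1 := by
  have hone : MeasurableSet {s | f s = 1} := hf.measurable (measurableSet_singleton 1)
  let T : Set X := {x | ∀ᵐ y ∂L x, f (x, y) = 1}
  have hT : MeasurableSet T :=
    Kernel.measurable_kernel_prodMk_left (κ := L) hone.compl (measurableSet_singleton 0)
  have hmove {s : X × Y} (hs : f s = 1) : ∀ᵐ x ∂G s.1, x ∈ T := by
    refine Measure.ae_ae_of_ae_compProd (p := fun t => f t = 1) ?_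
    rw [← apsProposal_apply]
    exact (absolutelyContinuous_mhKernel (measurable_apsAcceptance hu)
      (apsAcceptance_ne_zero hpos s)).ae_le (hf.ae_eq_one hs)
  have hne : T.Nonempty := by
    obtain ⟨s, hs⟩ := hex
    exact (hmove hs).exists
  have habs : ∀ x ∈ T, G x Tᶜ = 0 := fun x hx => by
    obtain ⟨y, hy⟩ := Eventually.exists (f := ae (L x)) hx
    exact hmove hy
  rw [Measure.ae_compProd_iff hone]
  exact measure_compl_eq_zero_of_absorbing hirr hT hne habs

variable {ν : Measure X} [SFinite ν]

section Target

include hu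

omit [IsMarkovKernel L] [SFinite ν] in
lemma compProd_absolutelyContinuous_apsTarget (hpos : ∀ s, 0 < u s) :
    ν ⊗ₘ L ≪ apsTarget ν L u :=
  withDensity_absolutelyContinuous' hu.ennreal_ofReal.aemeasurable
    (ae_of_all _ fun s => (ENNReal.ofReal_pos.2 (hpos s)).ne')

lemma apsTarget_ne_zero (hν : ν ≠ 0) (hpos : ∀ s, 0 < u s) : apsTarget ν L u ≠ 0 := by
  intro h
  have hac := compProd_absolutelyContinuous_apsTarget (ν := ν) L hu hpos
  rw [h, Measure.absolutelyContinuous_zero_iff] at hac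
  have huniv := Measure.compProd_apply_univ (μ := ν) (κ := L)
  rw [hac] at huniv
  exact hν (Measure.measure_univ_eq_zero.1 huniv.symm)

end Target

variable (g : CondDensity X ν)

lemma apsProposal_eq_withDensity (s : X × Y) :
    apsProposal g.kernel L s =
      (ν ⊗ₘ L).withDensity fun t => ENNReal.ofReal (g.p s.1 t.1) := by
  have hg : Measurable fun x => ENNReal.ofReal (g.p s.1 x) :=
    g.measurable_ofReal.comp measurable_prodMk_left
  have hg' : Measurable fun t : X × Y => ENNReal.ofReal (g.p s.1 t.1) := hg.comp measurable_fst
  rw [apsProposal_apply, g.kernel_apply]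
  ext B hB
  rw [Measure.compProd_apply hB, withDensity_apply _ hB, ← lintegral_indicator hB,
    Measure.lintegral_compProd (hg'.indicator hB),
    lintegral_withDensity_eq_lintegral_mul _ hg (Kernel.measurable_kernel_prodMk_left hB)]
  refine lintegral_congr fun x => ?_
  have hslice : (fun y => B.indicator (fun t => ENNReal.ofReal (g.p s.1 t.1)) (x, y)) =
      (Prod.mk x ⁻¹' B).indicator fun _ => ENNReal.ofReal (g.p s.1 x) := rfl
  rw [hslice, lintegral_indicator_const (measurable_prodMk_left hB), Pi.mul_apply]

theorem isReversible_apsKernel (hg : g.IsSymmetric) (hpos : ∀ s, 0 < u s) :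
    (apsKernel g.kernel L u hu).IsReversible (apsTarget ν L u) := by
  have hq : Measurable (Function.uncurry fun s t : X × Y => ENNReal.ofReal (g.p s.1 t.1)) :=
    g.measurable_ofReal.comp
      (by fun_prop : Measurable fun p : (X × Y) × (X × Y) => (p.1.1, p.2.1))
  refine isReversible_mhKernel_of_density (measurable_apsAcceptance hu) hu.ennreal_ofReal hq
    (apsProposal_eq_withDensity L g) fun s t => ?_
  rw [mul_left_comm, mul_left_comm (ENNReal.ofReal (u t)), ofReal_mul_apsAcceptance hpos,
    ofReal_mul_apsAcceptance hpos, hg, min_comm]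

lemma invariant_apsKernel (hg : g.IsSymmetric) (hpos : ∀ s, 0 < u s) :
    (apsKernel g.kernel L u hu).Invariant (normalized (apsTarget ν L u)) :=
  invariant_normalized (isReversible_apsKernel L hu g hg hpos).invariant

lemma eq_zero_of_isHarmonic_apsKernel (hpos : ∀ s, 0 < u s) {f : X × Y → ℝ≥0∞}
    (hf : IsHarmonic (apsKernel g.kernel L u hu) f) (hzero : ∀ᵐ s ∂(ν ⊗ₘ L), f s = 0)
    (s : X × Y) : f s = 0 := by
  refine hf.eq_zero_of_mhKernel (measurable_apsAcceptance hu) apsAcceptance_le_one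
    (apsAcceptance_ne_zero hpos) ?_
  rw [apsProposal_eq_withDensity]
  exact (withDensity_absolutelyContinuous _ _).ae_le hzero

theorem ae_tendsto_visitFreq_apsRun (hg : g.IsSymmetric) (hpos : ∀ s, 0 < u s)
    (hirr : Kernel.IsIrreducible ν g.kernel) (hν : ν ≠ 0)
    (hfin : apsTarget ν L u Set.univ ≠ ∞) (x₀ : X) {B : Set X} (hB : MeasurableSet B) :
    ∀ᵐ z ∂(apsRun g.kernel L u hu x₀), ∀ K,
      Tendsto (fun M => visitFreq B K M fun i => (z i).1) atTop
        (𝓝 (((normalized (apsTarget ν L u)).map Prod.fst).real B)) := by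
  have hprob := isProbabilityMeasure_normalized (apsTarget_ne_zero (ν := ν) L hu hν hpos) hfin
  have hac : normalized (apsTarget ν L u) ≪ ν ⊗ₘ L :=
    Measure.smul_absolutelyContinuous.trans (withDensity_absolutelyContinuous _ _)
  have hac' : ν ⊗ₘ L ≪ normalized (apsTarget ν L u) :=
    (compProd_absolutelyContinuous_apsTarget L hu hpos).trans
      (Measure.absolutelyContinuous_smul (ENNReal.inv_ne_zero.2 hfin))
  have hBX : MeasurableSet (Prod.fst ⁻¹' B : Set (X × Y)) := measurable_fst hB
  have hlln := ae_tendsto_birkhoffAverage_chainLaw (invariant_apsKernel L hu g hg hpos)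
    (fun f hf hex => hac.ae_le (ae_eq_one_of_isHarmonic_apsKernel L hu hpos hirr hf hex))
    (fun f hf hzero => eq_zero_of_isHarmonic_apsKernel L hu g hpos hf (hac'.ae_le hzero))
    (drawFrom L x₀) (measurable_one.indicator hBX) ((integrable_const (1 : ℝ)).indicator hBX)
  filter_upwards [hlln] with z hz K
  rw [measureReal_def, Measure.map_apply measurable_fst hB, ← measureReal_def,
    ← integral_indicator_one hBX]
  exact tendsto_visitFreq (B := Prod.fst ⁻¹' B) K hz

end APS

section Windows

/-- Windows (closed balls) of bandwidth `h < r` have finite `ν`-measure, bounded away from zero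
uniformly in the centre, and changing little, uniformly in the centre, with the bandwidth. This is
what comparing density estimates at different draws requires of the reference measure. -/
structure HasRegularWindows {S : Type*} [PseudoMetricSpace S] [MeasurableSpace S]
    (ν : Measure S) (r : ℝ) : Prop where
  measure_ne_top : ∀ h, 0 < h → h < r → ∀ y, ν (Metric.closedBall y h) ≠ ∞
  exists_le : ∀ h, 0 < h → h < r → ∃ c > 0, ∀ y, c ≤ ν.real (Metric.closedBall y h)
  exists_ratio : ∀ h, 0 < h → h < r → ∀ η > 1, ∃ δ > 0, δ < h ∧ h + δ < r ∧
    ∀ y, ν.real (Metric.closedBall y (h + δ)) ≤ η * ν.real (Metric.closedBall y (h - δ))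

lemma HasRegularWindows.ne_zero {S : Type*} [PseudoMetricSpace S] [MeasurableSpace S] [Nonempty S]
    {ν : Measure S} {r : ℝ} (hν : HasRegularWindows ν r) (hr : 0 < r) : ν ≠ 0 := by
  rintro rfl
  obtain ⟨c, hc, hle⟩ := hν.exists_le (r / 2) (half_pos hr) (half_lt_self hr)
  exact (hle (Classical.arbitrary S)).not_gt (by simpa using hc)

section Convex

variable {E : Type*} [NormedAddCommGroup E] [NormedSpace ℝ E] [FiniteDimensional ℝ E]
  [MeasurableSpace E] [BorelSpace E] (μ : Measure E) [μ.IsAddHaarMeasure]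

lemma measureReal_closedBall_inter_le {R : Set E} (hR : Convex ℝ R) {p : E} (hp : p ∈ R)
    {r₁ r₂ : ℝ} (hr₁ : 0 < r₁) (hr : r₁ ≤ r₂) :
    μ.real (Metric.closedBall p r₂ ∩ R) ≤
      (r₂ / r₁) ^ Module.finrank ℝ E * μ.real (Metric.closedBall p r₁ ∩ R) := by
  have hr₂ : 0 < r₂ := hr₁.trans_le hr
  have hshrink : AffineMap.homothety p (r₁ / r₂) '' (Metric.closedBall p r₂ ∩ R) ⊆
      Metric.closedBall p r₁ ∩ R := by
    rintro _ ⟨x, ⟨hx, hxR⟩, rfl⟩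
    constructor
    · rw [Metric.mem_closedBall] at hx ⊢
      rw [dist_comm, dist_center_homothety, Real.norm_of_nonneg (by positivity), dist_comm]
      calc r₁ / r₂ * dist x p ≤ r₁ / r₂ * r₂ := by gcongr
        _ = r₁ := div_mul_cancel₀ _ hr₂.ne'
    · rw [AffineMap.homothety_eq_lineMap]
      exact hR.lineMap_mem hp hxR ⟨by positivity, (div_le_one hr₂).2 hr⟩
  have hfin : μ (Metric.closedBall p r₁ ∩ R) ≠ ∞ :=
    ne_top_of_le_ne_top measure_closedBall_lt_top.ne (measure_mono Set.inter_subset_left)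
  have hscale := measureReal_mono hshrink hfin
  rw [measureReal_def, Measure.addHaar_image_homothety, ENNReal.toReal_mul, ← measureReal_def,
    ENNReal.toReal_ofReal (abs_nonneg _), abs_of_nonneg (by positivity), div_pow,
    div_mul_eq_mul_div, div_le_iff₀ (by positivity)] at hscale
  rw [div_pow, div_mul_eq_mul_div, le_div_iff₀ (by positivity)]
  linarith

lemma exists_add_div_sub_pow_le {h r η : ℝ} (h0 : 0 < h) (hr : h < r) (hη : 1 < η) (n : ℕ) :
    ∃ δ > 0, δ < h ∧ h + δ < r ∧ ((h + δ) / (h - δ)) ^ n ≤ η := by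
  have hcont : ContinuousAt (fun δ : ℝ => ((h + δ) / (h - δ)) ^ n) 0 :=
    (ContinuousAt.div (by fun_prop) (by fun_prop) (by simpa using h0.ne')).pow n
  have hratio : ∀ᶠ δ : ℝ in 𝓝[>] 0, ((h + δ) / (h - δ)) ^ n < η :=
    nhdsWithin_le_nhds (hcont.eventually_lt_const (by simpa [h0.ne'] using hη))
  have hsmall : ∀ᶠ δ : ℝ in 𝓝[>] 0, δ < h ∧ δ < r - h :=
    nhdsWithin_le_nhds ((eventually_lt_nhds h0).and (eventually_lt_nhds (sub_pos.2 hr)))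
  obtain ⟨δ, ⟨hδη, hδh, hδr⟩, hδ⟩ := ((hratio.and hsmall).and self_mem_nhdsWithin).exists
  exact ⟨δ, hδ, hδh, by linarith, hδη.le⟩

lemma hasRegularWindows_comap_of_convex {S : Type*} [MetricSpace S] [MeasurableSpace S]
    [BorelSpace S] {e : S → E} (he : Isometry e) (hmeas : MeasurableSet (Set.range e))
    (hconv : Convex ℝ (Set.range e))
    (hfat : ∀ h > 0, ∃ t > 0, ∀ y ∈ Set.range e, ∃ z,
      Metric.closedBall z t ⊆ Metric.closedBall y h ∩ Set.range e) (r : ℝ) :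
    HasRegularWindows (μ.comap e) r := by
  have hball (y : S) (h : ℝ) : μ.comap e (Metric.closedBall y h) =
      μ (Metric.closedBall (e y) h ∩ Set.range e) := by
    rw [(he.isEmbedding.measurableEmbedding hmeas).comap_apply, ← he.preimage_closedBall,
      Set.image_preimage_eq_inter_range]
  have hballr (y : S) (h : ℝ) : (μ.comap e).real (Metric.closedBall y h) =
      μ.real (Metric.closedBall (e y) h ∩ Set.range e) := congrArg ENNReal.toReal (hball y h)
  have hfin (p : E) (h : ℝ) : μ (Metric.closedBall p h ∩ Set.range e) ≠ ∞ :=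
    ne_top_of_le_ne_top measure_closedBall_lt_top.ne (measure_mono Set.inter_subset_left)
  refine ⟨fun h _ _ y => hball y h ▸ hfin _ _, fun h h0 _ => ?_, fun h h0 hr η hη => ?_⟩
  · obtain ⟨t, ht, hsub⟩ := hfat h h0
    refine ⟨μ.real (Metric.closedBall (0 : E) t), ENNReal.toReal_pos
      (Metric.measure_closedBall_pos _ _ ht).ne' measure_closedBall_lt_top.ne, fun y => ?_⟩
    obtain ⟨z, hz⟩ := hsub (e y) ⟨y, rfl⟩
    rw [hballr, measureReal_def, ← Measure.addHaar_closedBall_center μ z t]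
    exact measureReal_mono hz (hfin _ _)
  · obtain ⟨δ, hδ, hδh, hδr, hratio⟩ :=
      exists_add_div_sub_pow_le h0 hr hη (Module.finrank ℝ E)
    refine ⟨δ, hδ, hδh, hδr, fun y => ?_⟩
    rw [hballr, hballr]
    refine (measureReal_closedBall_inter_le μ hconv ⟨y, rfl⟩ (sub_pos.2 hδh)
      (by linarith)).trans ?_
    gcongr

end Convex

lemma eventually_exists_closedBall_subset {I : Set ℝ} (hI : I.OrdConnected)
    (hne : (interior I).Nonempty) :
    ∀ᶠ t in 𝓝[>] (0 : ℝ), ∀ y ∈ I, ∃ z, dist z y ≤ t ∧ Metric.closedBall z t ⊆ I := by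
  obtain ⟨x, hx⟩ := hne
  obtain ⟨ε, hε, hball⟩ := Metric.isOpen_iff.1 isOpen_interior x hx
  have hsub : Set.Icc x (x + ε / 2) ⊆ I := fun y hy => interior_subset <| hball <| by
    rw [Metric.mem_ball, Real.dist_eq, abs_lt]
    constructor <;> linarith [hy.1, hy.2]
  have hsmall : ∀ᶠ t in 𝓝[>] (0 : ℝ), t < ε / 8 :=
    nhdsWithin_le_nhds (eventually_lt_nhds (by positivity))
  filter_upwards [hsmall, self_mem_nhdsWithin] with t ht (ht0 : 0 < t) y hy
  rcases le_total y (x + ε / 4) with hyx | hyx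
  · refine ⟨y + t, by simp [abs_of_pos ht0], fun w hw => ?_⟩
    rw [Real.closedBall_eq_Icc] at hw
    refine hI.out hy (hsub (Set.right_mem_Icc.2 (by linarith))) ⟨?_, ?_⟩ <;> linarith [hw.1, hw.2]
  · refine ⟨y - t, by simp [abs_of_pos ht0], fun w hw => ?_⟩
    rw [Real.closedBall_eq_Icc] at hw
    refine hI.out (hsub (Set.left_mem_Icc.2 (by linarith))) hy ⟨?_, ?_⟩ <;> linarith [hw.1, hw.2]

lemma exists_closedBall_subset_box {n : ℕ} {I : Fin n → Set ℝ}
    (hI : ∀ i, (I i).OrdConnected ∧ (interior (I i)).Nonempty) {h : ℝ} (h0 : 0 < h) :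
    ∃ t > 0, ∀ y ∈ {x : EuclideanSpace ℝ (Fin n) | ∀ i, x i ∈ I i}, ∃ z,
      Metric.closedBall z t ⊆ Metric.closedBall y h ∩ {x | ∀ i, x i ∈ I i} := by
  have hbox : ∀ᶠ t in 𝓝[>] (0 : ℝ), ∀ i, ∀ y ∈ I i, ∃ z,
      dist z y ≤ t ∧ Metric.closedBall z t ⊆ I i :=
    eventually_all.2 fun i => eventually_exists_closedBall_subset (hI i).1 (hI i).2
  have hsmall : ∀ᶠ t in 𝓝[>] (0 : ℝ), t + √n * t < h := by
    have hcont : Continuous fun t : ℝ => t + √n * t := by fun_prop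
    exact nhdsWithin_le_nhds (hcont.continuousAt.eventually_lt_const (by simpa using h0))
  obtain ⟨t, ⟨hbox, hth⟩, ht : 0 < t⟩ := ((hbox.and hsmall).and self_mem_nhdsWithin).exists
  refine ⟨t, ht, fun y hy => ?_⟩
  choose z hzy hzI using fun i => hbox i (y i) (hy i)
  have hdist : dist (WithLp.toLp 2 z) y ≤ √n * t := by
    have hsum : ∑ i, dist (z i) (y i) ^ 2 ≤ n * t ^ 2 :=
      (Finset.sum_le_card_nsmul _ _ (t ^ 2) fun i _ =>
        pow_le_pow_left₀ dist_nonneg (hzy i) 2).trans_eq (by simp)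
    calc dist (WithLp.toLp 2 z) y = √(∑ i, dist (z i) (y i) ^ 2) := EuclideanSpace.dist_eq _ _
      _ ≤ √(n * t ^ 2) := Real.sqrt_le_sqrt hsum
      _ = √n * t := by rw [Real.sqrt_mul (by positivity), Real.sqrt_sq ht.le]
  refine ⟨WithLp.toLp 2 z, fun x hx => ⟨?_, fun i => hzI i ?_⟩⟩ <;>
    rw [Metric.mem_closedBall] at hx ⊢
  · linarith [dist_triangle x (WithLp.toLp 2 z) y]
  · exact (PiLp.dist_apply_le x (WithLp.toLp 2 z) i).trans hx

variable {S : Type*} [MetricSpace S] [MeasurableSpace S] [BorelSpace S]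

lemma hasRegularWindows_count (hd : ∀ x y : S, x ≠ y → dist x y = 1) :
    HasRegularWindows (Measure.count : Measure S) 1 := by
  have hsingleton (y : S) {h : ℝ} (h0 : 0 ≤ h) (h1 : h < 1) : Metric.closedBall y h = {y} := by
    refine Set.Subset.antisymm (fun x hx => ?_) (by simpa using h0)
    by_contra hne
    rw [Metric.mem_closedBall, hd x y hne] at hx
    exact hx.not_gt h1
  have hcount (y : S) {h : ℝ} (h0 : 0 ≤ h) (h1 : h < 1) :
      (Measure.count : Measure S) (Metric.closedBall y h) = 1 := by
    rw [hsingleton y h0 h1, Measure.count_singleton]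
  refine ⟨fun h h0 h1 y => by simp [hcount y h0.le h1],
    fun h h0 h1 => ⟨1, one_pos, fun y => by simp [measureReal_def, hcount y h0.le h1]⟩,
    fun h h0 h1 η hη => ?_⟩
  obtain ⟨δ, hδ, hδ'⟩ := exists_between (lt_min h0 (sub_pos.2 h1))
  rw [lt_min_iff] at hδ'
  refine ⟨δ, hδ, hδ'.1, by linarith, fun y => ?_⟩
  rw [measureReal_def, measureReal_def, hcount y (by linarith) (by linarith),
    hcount y (by linarith) (by linarith)]
  simpa using hη.le

lemma IsDiscreteOrInterval.hasRegularWindows (ν : Measure S) [h : IsDiscreteOrInterval ν] :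
    HasRegularWindows ν 1 := by
  rcases h.discrete_or_interval with ⟨_, hd, rfl⟩ | ⟨n, I, e, hI, he, hrange, rfl⟩
  · exact hasRegularWindows_count hd
  · have hmeas : MeasurableSet (Set.range e) := by
      rw [hrange, Set.ofPred_forall]
      exact .iInter fun i => (hI i).1.measurableSet.preimage (by fun_prop)
    have hconv : Convex ℝ (Set.range e) := by
      rw [hrange]
      exact fun x hx y hy a b ha hb hab i => (hI i).1.convex (hx i) (hy i) ha hb hab
    refine hasRegularWindows_comap_of_convex volume he hmeas hconv (fun h h0 => ?_) 1
    rw [hrange]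
    exact exists_closedBall_subset_box hI h0

lemma IsDiscreteOrInterval.secondCountableTopology (ν : Measure S) [h : IsDiscreteOrInterval ν] :
    SecondCountableTopology S := by
  rcases h.discrete_or_interval with ⟨_, _, _⟩ | ⟨n, I, e, _, he, _⟩
  · exact UniformSpace.secondCountable_of_separable S
  · exact he.isEmbedding.secondCountableTopology

end Windows

section VisitFreq

variable {X : Type*}

lemma visitFreq_eq_sum (B : Set X) (K M : ℕ) (z : ℕ → X) :
    visitFreq B K M z = (∑ i ∈ Finset.Ioc K M, B.indicator (1 : X → ℝ) (z i)) / M := by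
  classical
  rw [visitFreq, Finset.card_filter, Nat.cast_sum]
  simp only [Nat.cast_ite, Nat.cast_one, Nat.cast_zero, Set.indicator_apply, Pi.one_apply]

lemma visitFreq_mono {B C : Set X} (h : B ⊆ C) (K M : ℕ) (z : ℕ → X) :
    visitFreq B K M z ≤ visitFreq C K M z := by
  rw [visitFreq_eq_sum, visitFreq_eq_sum]
  gcongr with i
  exact zero_le_one (α := ℝ)

lemma exists_mem_of_visitFreq_pos {B : Set X} {K M : ℕ} {z : ℕ → X} (h : 0 < visitFreq B K M z) :
    ∃ i ∈ Finset.Ioc K M, z i ∈ B := by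
  by_contra! hB
  rw [visitFreq_eq_sum, Finset.sum_eq_zero fun i hi => Set.indicator_of_notMem (hB i hi) _] at h
  simp at h

lemma indicator_add_sum_indicator_le_one {B : Set X} {C : ℕ → Set X} {T : Finset ℕ}
    (hd : Pairwise (Function.onFun Disjoint C)) (hB : ∀ k ∈ T, Disjoint (C k) B) (x : X) :
    B.indicator (1 : X → ℝ) x + ∑ k ∈ T, (C k).indicator (1 : X → ℝ) x ≤ 1 := by
  by_cases hx : ∃ k ∈ T, x ∈ C k
  · obtain ⟨k, hk, hxk⟩ := hx
    have hxB : x ∉ B := Set.disjoint_left.1 (hB k hk) hxk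
    have hxC : ∀ j ∈ T, j ≠ k → (C j).indicator (1 : X → ℝ) x = 0 := fun j _ hjk =>
      Set.indicator_of_notMem (Set.disjoint_left.1 (hd hjk.symm) hxk) _
    rw [Finset.sum_eq_single_of_mem k hk hxC, Set.indicator_of_notMem hxB,
      Set.indicator_of_mem hxk, zero_add, Pi.one_apply]
  · push Not at hx
    rw [Finset.sum_eq_zero fun k hk => Set.indicator_of_notMem (hx k hk) _, add_zero]
    exact Set.indicator_le_self' (fun _ _ => zero_le_one) _

lemma visitFreq_add_sum_le_one {B : Set X} {C : ℕ → Set X} {T : Finset ℕ}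
    (hd : Pairwise (Function.onFun Disjoint C)) (hB : ∀ k ∈ T, Disjoint (C k) B)
    (K M : ℕ) (z : ℕ → X) :
    visitFreq B K M z + ∑ k ∈ T, visitFreq (C k) K M z ≤ 1 := by
  simp_rw [visitFreq_eq_sum]
  rw [← Finset.sum_div, ← add_div, Finset.sum_comm, ← Finset.sum_add_distrib]
  refine div_le_one_of_le₀ ?_ (Nat.cast_nonneg _)
  calc ∑ i ∈ Finset.Ioc K M, (B.indicator (1 : X → ℝ) (z i) +
        ∑ k ∈ T, (C k).indicator (1 : X → ℝ) (z i))
      ≤ ∑ _i ∈ Finset.Ioc K M, (1 : ℝ) :=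
        Finset.sum_le_sum fun i _ => indicator_add_sum_indicator_le_one hd hB (z i)
    _ ≤ M := by simp

end VisitFreq

section UniformUpperBound

lemma exists_partition_dist_le {X : Type*} [PseudoMetricSpace X] [MeasurableSpace X]
    [OpensMeasurableSpace X] [TopologicalSpace.SeparableSpace X] [Nonempty X] {δ : ℝ}
    (hδ : 0 < δ) :
    ∃ C : ℕ → Set X, (∀ k, MeasurableSet (C k)) ∧ Pairwise (Function.onFun Disjoint C) ∧
      (⋃ k, C k) = Set.univ ∧ ∀ k, ∀ x ∈ C k, ∀ y ∈ C k, dist x y ≤ δ := by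
  let D : ℕ → Set X := fun k => Metric.closedBall (TopologicalSpace.denseSeq X k) (δ / 2)
  refine ⟨disjointed D, fun k => MeasurableSet.disjointed (fun _ => measurableSet_closedBall) k,
    disjoint_disjointed D, ?_, fun k x hx y hy => ?_⟩
  · rw [iUnion_disjointed, Set.eq_univ_iff_forall]
    intro x
    obtain ⟨k, hk⟩ := (TopologicalSpace.denseRange_denseSeq X).exists_dist_lt x (half_pos hδ)
    exact Set.mem_iUnion.2 ⟨k, hk.le⟩
  · have hx' := Metric.mem_closedBall.1 (disjointed_subset D k hx)
    have hy' := Metric.mem_closedBall.1 (disjointed_subset D k hy)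
    linarith [dist_triangle_right x y (TopologicalSpace.denseSeq X k)]

variable {X : Type*} [MeasurableSpace X] {ρ : Measure X}
  {C : ℕ → Set X} (hCm : ∀ k, MeasurableSet (C k)) (hd : Pairwise (Function.onFun Disjoint C))

include hCm hd

lemma tendsto_sum_measureReal_of_partition [IsProbabilityMeasure ρ] (hU : (⋃ k, C k) = Set.univ) :
    Tendsto (fun J => ∑ k ∈ Finset.range J, ρ.real (C k)) atTop (𝓝 1) := by
  have htsum := ENNReal.tendsto_nat_tsum fun k => ρ (C k)
  rw [← measure_iUnion hd hCm, hU, measure_univ] at htsum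
  refine ((ENNReal.tendsto_toReal ENNReal.one_ne_top).comp htsum).congr fun J => ?_
  rw [Function.comp, ENNReal.toReal_sum fun k _ => measure_ne_top _ _]
  rfl

lemma exists_eventually_lt_sum_visitFreq [IsProbabilityMeasure ρ] (hU : (⋃ k, C k) = Set.univ)
    {z : ℕ → X} {K : ℕ}
    (hz : ∀ k, Tendsto (fun M => visitFreq (C k) K M z) atTop (𝓝 (ρ.real (C k))))
    {σ : ℝ} (hσ : 0 < σ) :
    ∃ J : ℕ, 1 - σ < ∑ k ∈ Finset.range J, ρ.real (C k) ∧ ∀ᶠ M in atTop, ∀ T ⊆ Finset.range J,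
      ∑ k ∈ T, ρ.real (C k) - σ < ∑ k ∈ T, visitFreq (C k) K M z := by
  obtain ⟨J, hJ⟩ := ((tendsto_sum_measureReal_of_partition (ρ := ρ) hCm hd hU).eventually_const_lt
    (sub_lt_self 1 hσ)).exists
  refine ⟨J, hJ, ?_⟩
  have hev : ∀ᶠ M in atTop, ∀ T ∈ (Finset.range J).powerset,
      ∑ k ∈ T, ρ.real (C k) - σ < ∑ k ∈ T, visitFreq (C k) K M z :=
    (Finset.range J).powerset.eventually_all.2 fun T _ =>
      (tendsto_finsetSum T fun k _ => hz k).eventually_const_lt (sub_lt_self _ hσ)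
  simpa only [Finset.mem_powerset] using hev

/-- The visits to a ball are those which do not go to the cells away from it, and these cells are
visited at least about as often as in the limit. -/
lemma eventually_visitFreq_closedBall_le [PseudoMetricSpace X] [IsProbabilityMeasure ρ]
    (hU : (⋃ k, C k) = Set.univ) {δ : ℝ} (hC : ∀ k, ∀ x ∈ C k, ∀ y ∈ C k, dist x y ≤ δ)
    {z : ℕ → X} {K : ℕ}
    (hz : ∀ k, Tendsto (fun M => visitFreq (C k) K M z) atTop (𝓝 (ρ.real (C k))))
    {σ : ℝ} (hσ : 0 < σ) :
    ∀ᶠ M in atTop, ∀ y h, visitFreq (Metric.closedBall y h) K M z ≤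
      ρ.real (Metric.closedBall y (h + δ)) + σ := by
  classical
  obtain ⟨J, hJ, hev⟩ := exists_eventually_lt_sum_visitFreq hCm hd hU hz (half_pos hσ)
  filter_upwards [hev] with M hM y h
  let far := (Finset.range J).filter fun k => Disjoint (C k) (Metric.closedBall y h)
  let near := (Finset.range J).filter fun k => ¬ Disjoint (C k) (Metric.closedBall y h)
  have hvisits : visitFreq (Metric.closedBall y h) K M z + ∑ k ∈ far, visitFreq (C k) K M z ≤ 1 :=
    visitFreq_add_sum_le_one hd (fun k hk => (Finset.mem_filter.1 hk).2) _ _ _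
  have hsplit : ∑ k ∈ far, ρ.real (C k) + ∑ k ∈ near, ρ.real (C k) =
      ∑ k ∈ Finset.range J, ρ.real (C k) := Finset.sum_filter_add_sum_filter_not _ _ _
  have hnear : ∑ k ∈ near, ρ.real (C k) ≤ ρ.real (Metric.closedBall y (h + δ)) := by
    rw [← measureReal_biUnion_finset (fun i _ j _ hij => hd hij) fun k _ => hCm k]
    refine measureReal_mono (Set.iUnion₂_subset fun k hk x hx => ?_)
    obtain ⟨w, hw, hwB⟩ := Set.not_disjoint_iff.1 (Finset.mem_filter.1 hk).2
    rw [Metric.mem_closedBall] at hwB ⊢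
    linarith [dist_triangle x w y, hC k x hx w hw]
  linarith [hM far (Finset.filter_subset _ _)]

end UniformUpperBound

section SampleMode

variable {X : Type*} [MetricSpace X] [MeasurableSpace X] {ν : Measure X}

lemma exists_sampleMode_eq (ν : Measure X) (h : ℝ) {K M : ℕ} (hKM : K < M) (z : ℕ → X) :
    ∃ j ∈ Finset.Ioc K M, sampleMode ν h K M z = z j ∧
      ∀ i ∈ Finset.Ioc K M, densityScore ν h K M z i ≤ densityScore ν h K M z j := by
  obtain ⟨m, hm, hmax⟩ := Finset.exists_max_image (Finset.Ioc K M) (densityScore ν h K M z)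
    (Finset.nonempty_Ioc.2 hKM)
  obtain ⟨hj, hjmax⟩ := Nat.sInf_mem (s := {i | i ∈ Finset.Ioc K M ∧
    ∀ j ∈ Finset.Ioc K M, densityScore ν h K M z j ≤ densityScore ν h K M z i}) ⟨m, hm, hmax⟩
  exact ⟨_, hj, rfl, hjmax⟩

lemma toReal_densityScore (h : ℝ) (K : ℕ) {M : ℕ} (hM : 0 < M) (z : ℕ → X) (i : ℕ) :
    (densityScore ν h K M z i).toReal =
      visitFreq (Metric.closedBall (z i) h) K M z * M / ν.real (Metric.closedBall (z i) h) := by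
  rw [densityScore, visitFreq, div_mul_cancel₀ _ (by positivity), ENNReal.toReal_div,
    ENNReal.toReal_natCast, measureReal_def]
  congr!

lemma visitFreq_mul_le_of_sampleMode {h : ℝ} (hν : ∀ y, 0 < ν.real (Metric.closedBall y h))
    {K M : ℕ} {z : ℕ → X} {i : ℕ} (hi : i ∈ Finset.Ioc K M) :
    visitFreq (Metric.closedBall (z i) h) K M z *
        ν.real (Metric.closedBall (sampleMode ν h K M z) h) ≤
      visitFreq (Metric.closedBall (sampleMode ν h K M z) h) K M z *
        ν.real (Metric.closedBall (z i) h) := by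
  have hKM : K < M := (Finset.mem_Ioc.1 hi).1.trans_le (Finset.mem_Ioc.1 hi).2
  have hM : 0 < M := (Nat.zero_le K).trans_lt hKM
  obtain ⟨j, -, hj, hmax⟩ := exists_sampleMode_eq ν h hKM z
  have hfin : densityScore ν h K M z j ≠ ∞ :=
    ENNReal.div_ne_top (ENNReal.natCast_ne_top _) (ENNReal.toReal_pos_iff.1 (hν (z j))).1.ne'
  have hle := ENNReal.toReal_mono hfin (hmax i hi)
  rw [toReal_densityScore h K hM, toReal_densityScore h K hM, div_le_div_iff₀ (hν _) (hν _),
    mul_right_comm, mul_right_comm _ (M : ℝ)] at hle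
  rw [hj]
  exact le_of_mul_le_mul_right hle (by positivity)

/-- Frequencies `p` and `q` of windows of volumes `v` and `w`, whose densities differ by at least
`b - a` up to errors which are small with respect to the volumes, are ordered as the densities. -/
lemma mul_lt_mul_of_density_gap {a b c v w p q : ℝ} (hab : a < b) (hc : 0 < c) (hv : c ≤ v)
    (hw : c ≤ w) (hp : b * v - (b - a) * c / 3 ≤ p) (hq : q ≤ a * w + (b - a) * c / 3) :
    q * v < p * w := by
  have hgap : 0 < b - a := sub_pos.2 hab
  have hv0 : 0 < v := hc.trans_le hv
  have hw0 : 0 < w := hc.trans_le hw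
  have hcw : (b - a) * (c * w) ≤ (b - a) * (v * w) := by gcongr
  have hcv : (b - a) * (c * v) ≤ (b - a) * (w * v) := by gcongr
  calc q * v ≤ (a * w + (b - a) * c / 3) * v := by gcongr
    _ < (b * v - (b - a) * c / 3) * w := by
        have := mul_pos hgap (mul_pos hv0 hw0)
        linarith
    _ ≤ p * w := by gcongr

lemma eventually_dist_sampleMode_lt {ρ : Measure X} {x : X} {h δ ε a b c : ℝ} (hab : a < b)
    (hc : 0 < c) (hlow : ∀ y, c ≤ ν.real (Metric.closedBall y h))
    (hfar : ∀ y, ε ≤ dist y x →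
      ρ.real (Metric.closedBall y (h + δ)) ≤ a * ν.real (Metric.closedBall y h))
    (hnear : ∀ y, dist y x ≤ δ →
      b * ν.real (Metric.closedBall y h) ≤ ρ.real (Metric.closedBall x (h - δ)))
    (hpos : 0 < ρ.real (Metric.closedBall x δ)) {z : ℕ → X} {K : ℕ}
    (hup : ∀ σ > 0, ∀ᶠ M in atTop, ∀ y, visitFreq (Metric.closedBall y h) K M z ≤
      ρ.real (Metric.closedBall y (h + δ)) + σ)
    (hz : Tendsto (fun M => visitFreq (Metric.closedBall x (h - δ)) K M z) atTop
      (𝓝 (ρ.real (Metric.closedBall x (h - δ)))))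
    (hzδ : Tendsto (fun M => visitFreq (Metric.closedBall x δ) K M z) atTop
      (𝓝 (ρ.real (Metric.closedBall x δ)))) :
    ∀ᶠ M in atTop, dist (sampleMode ν h K M z) x < ε := by
  have hσ : 0 < (b - a) * c / 3 := div_pos (mul_pos (sub_pos.2 hab) hc) three_pos
  filter_upwards [hup _ hσ, hz.eventually_const_lt (sub_lt_self _ hσ),
    hzδ.eventually_const_lt hpos] with M hupM hzM hvisit
  obtain ⟨i, hi, hix⟩ := exists_mem_of_visitFreq_pos hvisit
  rw [Metric.mem_closedBall] at hix
  have hzi : b * ν.real (Metric.closedBall (z i) h) - (b - a) * c / 3 ≤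
      visitFreq (Metric.closedBall (z i) h) K M z := by
    have hsub : Metric.closedBall x (h - δ) ⊆ Metric.closedBall (z i) h :=
      Metric.closedBall_subset_closedBall' (by linarith [dist_comm x (z i)])
    linarith [hnear (z i) hix, visitFreq_mono hsub K M z]
  by_contra! hw
  have hmode : visitFreq (Metric.closedBall (sampleMode ν h K M z) h) K M z ≤
      a * ν.real (Metric.closedBall (sampleMode ν h K M z) h) + (b - a) * c / 3 := by
    linarith [hfar _ hw, hupM (sampleMode ν h K M z)]
  exact (mul_lt_mul_of_density_gap hab hc (hlow _) (hlow _) hzi hmode).not_ge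
    (visitFreq_mul_le_of_sampleMode (fun y => hc.trans_le (hlow y)) hi)

end SampleMode

section DensityGap

variable {X : Type*} [MeasurableSpace X] {ν : Measure X} {f : X → ℝ≥0∞} {B : Set X}

lemma measureReal_withDensity_le (hB : MeasurableSet B) (hfin : ν B ≠ ∞) {c : NNReal}
    (hle : ∀ y ∈ B, f y ≤ c) : (ν.withDensity f).real B ≤ c * ν.real B := by
  have h : ν.withDensity f B ≤ c * ν B := by
    rw [withDensity_apply _ hB, ← setLIntegral_const]
    exact setLIntegral_mono' hB hle
  simpa [measureReal_def] using ENNReal.toReal_mono (ENNReal.mul_ne_top ENNReal.coe_ne_top hfin) h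

lemma le_measureReal_withDensity (hB : MeasurableSet B) (hfin : ν.withDensity f B ≠ ∞) {t : NNReal}
    (hle : ∀ y ∈ B, t ≤ f y) : t * ν.real B ≤ (ν.withDensity f).real B := by
  have h : t * ν B ≤ ν.withDensity f B := by
    rw [withDensity_apply _ hB, ← setLIntegral_const]
    exact setLIntegral_mono' hB hle
  simpa [measureReal_def] using ENNReal.toReal_mono hfin h

namespace HasRegularWindows

variable [MetricSpace X] [OpensMeasurableSpace X] {r : ℝ} (hν : HasRegularWindows ν r)
  {x : X} {h δ η : ℝ}

include hν

lemma measureReal_withDensity_far_le (h0 : 0 < h) (hδ : 0 < δ) (hδr : h + δ < r) (hη : 0 ≤ η)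
    (hratio : ∀ y, ν.real (Metric.closedBall y (h + δ)) ≤ η * ν.real (Metric.closedBall y (h - δ)))
    {c : NNReal} {ε : ℝ} (hc : ∀ y, ε / 2 ≤ dist y x → f y ≤ c) (hε : h + δ ≤ ε / 2) {y : X}
    (hy : ε ≤ dist y x) :
    (ν.withDensity f).real (Metric.closedBall y (h + δ)) ≤
      c * η * ν.real (Metric.closedBall y h) := by
  have hfc : ∀ w ∈ Metric.closedBall y (h + δ), f w ≤ c := fun w hw => hc w <| by
    rw [Metric.mem_closedBall] at hw
    linarith [dist_triangle y w x, dist_comm y w]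
  have hmono : ν.real (Metric.closedBall y (h - δ)) ≤ ν.real (Metric.closedBall y h) :=
    measureReal_mono (Metric.closedBall_subset_closedBall (by linarith))
      (hν.measure_ne_top h h0 (by linarith) y)
  calc (ν.withDensity f).real (Metric.closedBall y (h + δ))
      ≤ c * ν.real (Metric.closedBall y (h + δ)) :=
        measureReal_withDensity_le measurableSet_closedBall
          (hν.measure_ne_top _ (by linarith) hδr y) hfc
    _ ≤ c * (η * ν.real (Metric.closedBall y h)) := by
        gcongr
        exact (hratio y).trans (by gcongr)
    _ = c * η * ν.real (Metric.closedBall y h) := by ring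

lemma le_measureReal_withDensity_near (h0 : 0 < h) (hδ : 0 < δ) (hδr : h + δ < r) (hη : 0 < η)
    (hratio : ∀ y, ν.real (Metric.closedBall y (h + δ)) ≤ η * ν.real (Metric.closedBall y (h - δ)))
    {t : NNReal} (hfin : ν.withDensity f Set.univ ≠ ∞) (ht : ∀ w ∈ Metric.closedBall x h, t ≤ f w)
    {y : X} (hy : dist y x ≤ δ) :
    t / η * ν.real (Metric.closedBall y h) ≤
      (ν.withDensity f).real (Metric.closedBall x (h - δ)) := by
  have hmono : ν.real (Metric.closedBall y h) ≤ ν.real (Metric.closedBall x (h + δ)) :=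
    measureReal_mono (Metric.closedBall_subset_closedBall' (by linarith))
      (hν.measure_ne_top _ (by linarith) hδr x)
  calc t / η * ν.real (Metric.closedBall y h)
      ≤ t / η * (η * ν.real (Metric.closedBall x (h - δ))) := by
        gcongr
        exact hmono.trans (hratio x)
    _ = t * ν.real (Metric.closedBall x (h - δ)) := by field_simp
    _ ≤ (ν.withDensity f).real (Metric.closedBall x (h - δ)) :=
        le_measureReal_withDensity measurableSet_closedBall
          (measure_ne_top_of_subset (Set.subset_univ _) hfin)
          fun w hw => ht w (Metric.closedBall_subset_closedBall (by linarith) hw)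

lemma exists_density_gap (hr : 0 < r) (hfin : ν.withDensity f Set.univ ≠ ∞)
    (hx : IsWellSeparatedArgmax f x) {ε : ℝ} (hε : 0 < ε) :
    ∃ a b h₀ : ℝ, a < b ∧ 0 < h₀ ∧ h₀ ≤ r ∧ ∀ h, 0 < h → h < h₀ → ∃ δ > 0,
      (∀ y, ε ≤ dist y x → (ν.withDensity f).real (Metric.closedBall y (h + δ)) ≤
        a * ν.real (Metric.closedBall y h)) ∧
      (∀ y, dist y x ≤ δ → b * ν.real (Metric.closedBall y h) ≤
        (ν.withDensity f).real (Metric.closedBall x (h - δ))) ∧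
      0 < (ν.withDensity f).real (Metric.closedBall x δ) := by
  obtain ⟨hcont, hsep⟩ := hx
  obtain ⟨c, hcx, hc⟩ := hsep (ε / 2) (half_pos hε)
  obtain ⟨t, hct, htx⟩ := exists_between hcx
  lift c to NNReal using (hct.trans htx).ne_top
  lift t to NNReal using htx.ne_top
  have hct' : (c : ℝ) < t := by exact_mod_cast hct
  have ht0 : (0 : ℝ) < t := c.2.trans_lt hct'
  obtain ⟨r₀, hr₀, hball⟩ := Metric.mem_nhds_iff.1 (hcont.eventually_const_lt htx)
  have ht {s : ℝ} (hs : s < r₀) : ∀ w ∈ Metric.closedBall x s, (t : ℝ≥0∞) ≤ f w := fun w hw =>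
    (hball (Metric.closedBall_subset_ball hs hw)).le
  obtain ⟨η, hη, hη1⟩ : ∃ η : ℝ, c * η * η < t ∧ 1 < η := by
    have hlim : Tendsto (fun η : ℝ => c * η * η) (𝓝[>] 1) (𝓝 c) :=
      ((by fun_prop : Continuous fun η : ℝ => c * η * η).tendsto' 1 c (by simp)).mono_left
        nhdsWithin_le_nhds
    exact ((hlim.eventually_lt_const hct').and self_mem_nhdsWithin).exists
  have hη0 : 0 < η := one_pos.trans hη1
  refine ⟨c * η, t / η, min r (min (ε / 4) r₀), (lt_div_iff₀ hη0).2 hη, by positivity,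
    min_le_left _ _, fun h h0 hlt => ?_⟩
  obtain ⟨hhr, hhε, hhr₀⟩ : h < r ∧ h < ε / 4 ∧ h < r₀ := by simpa only [lt_min_iff] using hlt
  obtain ⟨δ, hδ, hδh, hδr, hratio⟩ := hν.exists_ratio h h0 hhr η hη1
  refine ⟨δ, hδ,
    fun y => hν.measureReal_withDensity_far_le h0 hδ hδr hη0.le hratio hc (by linarith),
    fun y => hν.le_measureReal_withDensity_near h0 hδ hδr hη0 hratio hfin (ht hhr₀), ?_⟩
  obtain ⟨m, hm, hmν⟩ := hν.exists_le δ hδ (by linarith)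
  exact (mul_pos ht0 (hm.trans_le (hmν x))).trans_le (le_measureReal_withDensity
    measurableSet_closedBall (measure_ne_top_of_subset (Set.subset_univ _) hfin)
    (ht (hδh.trans hhr₀)))

/-- Countably many events are enough for the conclusion, so that it holds almost surely once each
of their frequencies converges almost surely. -/
theorem exists_forall_eventually_dist_sampleMode_lt [TopologicalSpace.SeparableSpace X]
    (hr : 0 < r) (hzero : ν.withDensity f ≠ 0) (hfin : ν.withDensity f Set.univ ≠ ∞)
    (hx : IsWellSeparatedArgmax f x) {ε : ℝ} (hε : 0 < ε) :
    ∃ h₀ > 0, ∀ h, 0 < h → h < h₀ → ∃ 𝒞 : Set (Set X), 𝒞.Countable ∧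
      (∀ C ∈ 𝒞, MeasurableSet C) ∧ ∀ (z : ℕ → X) (K : ℕ),
        (∀ C ∈ 𝒞, Tendsto (fun M => visitFreq C K M z) atTop
          (𝓝 ((normalized (ν.withDensity f)).real C))) →
        ∀ᶠ M in atTop, dist (sampleMode ν h K M z) x < ε := by
  obtain ⟨a, b, h₀, hab, hh₀, hh₀r, hgap⟩ := hν.exists_density_gap hr hfin hx hε
  refine ⟨h₀, hh₀, fun h h0 hlt => ?_⟩
  obtain ⟨δ, hδ, hfar, hnear, hpos⟩ := hgap h h0 hlt
  obtain ⟨c, hc, hcν⟩ := hν.exists_le h h0 (hlt.trans_le hh₀r)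
  have : Nonempty X := ⟨x⟩
  obtain ⟨C, hCm, hCd, hCU, hC⟩ := exists_partition_dist_le (X := X) hδ
  have := isProbabilityMeasure_normalized hzero hfin
  have hW : 0 < ((ν.withDensity f) Set.univ)⁻¹.toReal := ENNReal.toReal_pos
    (ENNReal.inv_ne_zero.2 hfin) (ENNReal.inv_ne_top.2 (Measure.measure_univ_ne_zero.2 hzero))
  refine ⟨Set.range C ∪ {Metric.closedBall x (h - δ), Metric.closedBall x δ},
    (Set.countable_range C).union (Set.toFinite _).countable, ?_, fun z K hz => ?_⟩
  · rintro _ (⟨k, rfl⟩ | rfl | rfl)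
    exacts [hCm k, measurableSet_closedBall, measurableSet_closedBall]
  have hreal (B : Set X) : (normalized (ν.withDensity f)).real B =
      ((ν.withDensity f) Set.univ)⁻¹.toReal * (ν.withDensity f).real B :=
    measureReal_ennreal_smul_apply _
  have hup (σ : ℝ) (hσ : σ > 0) := (eventually_visitFreq_closedBall_le hCm hCd hCU hC
    (fun k => hz _ (Or.inl ⟨k, rfl⟩)) hσ).mono fun M hM y => hM y h
  refine eventually_dist_sampleMode_lt (mul_lt_mul_of_pos_left hab hW) hc hcν
    (fun y hy => ?_) (fun y hy => ?_) ?_ hup (hz _ (Or.inr (Or.inl rfl)))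
    (hz _ (Or.inr (Or.inr rfl)))
  · rw [hreal, mul_assoc]
    exact mul_le_mul_of_nonneg_left (hfar y hy) hW.le
  · rw [hreal, mul_assoc]
    exact mul_le_mul_of_nonneg_left (hnear y hy) hW.le
  · rw [hreal]
    exact mul_pos hW hpos

end HasRegularWindows

end DensityGap

section ModeOfRun

variable {X Y : Type*} [MeasurableSpace X] [MeasurableSpace Y] {ν : Measure X}

lemma map_normalized {φ : X → Y} (hφ : Measurable φ)
    (m : Measure X) : (normalized m).map φ = normalized (m.map φ) := by
  rw [normalized, normalized, Measure.map_smul, Measure.map_apply hφ .univ, Set.preimage_univ]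

lemma map_fst_apsTarget [SFinite ν] (L : Kernel X Y) [IsSFiniteKernel L] {u : X × Y → ℝ}
    (hu : Measurable u) : (apsTarget ν L u).map Prod.fst =
      ν.withDensity fun a => ∫⁻ y, ENNReal.ofReal (u (a, y)) ∂L a := by
  ext B hB
  rw [Measure.map_apply measurable_fst hB, apsTarget,
    withDensity_apply _ (hB.preimage measurable_fst), withDensity_apply _ hB, ← Set.prod_univ,
    Measure.setLIntegral_compProd (by fun_prop) hB .univ]
  simp only [setLIntegral_univ]

theorem exists_forall_ae_dist_sampleMode_apsRun_lt [MetricSpace X] [BorelSpace X]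
    [SecondCountableTopology X] [SFinite ν] {r : ℝ} (hν : HasRegularWindows ν r) (hr : 0 < r)
    (L : Kernel X Y) [IsMarkovKernel L] {u : X × Y → ℝ} (hu : Measurable u)
    (g : CondDensity X ν) (hg : g.IsSymmetric) (hpos : ∀ s, 0 < u s)
    (hirr : Kernel.IsIrreducible ν g.kernel) (hfin : apsTarget ν L u Set.univ ≠ ∞) {x : X}
    (hx : IsWellSeparatedArgmax (fun a => ∫⁻ y, ENNReal.ofReal (u (a, y)) ∂L a) x)
    {ε : ℝ} (hε : 0 < ε) :
    ∃ h₀ > 0, ∀ h, 0 < h → h < h₀ → ∀ (x₀ : X) (K : ℕ),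
      ∀ᵐ z ∂(apsRun g.kernel L u hu x₀), ∀ᶠ M in atTop,
        dist (sampleMode ν h K M fun i => (z i).1) x < ε := by
  have : Nonempty X := ⟨x⟩
  have hν0 := hν.ne_zero hr
  have hT0 := apsTarget_ne_zero (ν := ν) L hu hν0 hpos
  have hmap := map_fst_apsTarget (ν := ν) L hu
  have hf0 : ν.withDensity (fun a => ∫⁻ y, ENNReal.ofReal (u (a, y)) ∂L a) ≠ 0 := by
    rwa [← hmap, Ne, Measure.map_eq_zero_iff measurable_fst.aemeasurable]
  have hffin : ν.withDensity (fun a => ∫⁻ y, ENNReal.ofReal (u (a, y)) ∂L a) Set.univ ≠ ∞ := by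
    rwa [← hmap, Measure.map_apply measurable_fst .univ, Set.preimage_univ]
  obtain ⟨h₀, hh₀, H⟩ := hν.exists_forall_eventually_dist_sampleMode_lt hr hf0 hffin hx hε
  refine ⟨h₀, hh₀, fun h h0 hlt x₀ K => ?_⟩
  obtain ⟨𝒞, h𝒞, hm, hmode⟩ := H h h0 hlt
  have hfreq : ∀ᵐ z ∂(apsRun g.kernel L u hu x₀), ∀ C ∈ 𝒞, ∀ K,
      Tendsto (fun M => visitFreq C K M fun i => (z i).1) atTop
        (𝓝 ((normalized ((apsTarget ν L u).map Prod.fst)).real C)) := by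
    rw [← map_normalized measurable_fst]
    exact (ae_ball_iff h𝒞).2 fun C hC =>
      ae_tendsto_visitFreq_apsRun L hu g hg hpos hirr hν0 hfin x₀ (hm C hC)
  rw [hmap] at hfreq
  filter_upwards [hfreq] with z hz
  exact hmode _ K fun C hC => hz C hC K

end ModeOfRun

section Measurability

lemma measurable_sInf_setOf_mem {Z : Type*} [MeasurableSpace Z] {s : ℕ → Set Z}
    (hs : ∀ i, MeasurableSet (s i)) : Measurable fun z => sInf {i | z ∈ s i} := by
  refine measurable_of_Iic fun n => ?_
  have hpre : (fun z => sInf {i | z ∈ s i}) ⁻¹' Set.Iic n = (⋃ i ≤ n, s i) ∪ (⋃ i, s i)ᶜ := by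
    ext z
    simp only [Set.mem_preimage, Set.mem_Iic, Set.mem_union, Set.mem_iUnion, Set.mem_compl_iff,
      exists_prop]
    constructor
    · intro hz
      by_cases hne : ∃ i, z ∈ s i
      · exact .inl ⟨_, hz, Nat.sInf_mem hne⟩
      · exact .inr hne
    · rintro (⟨i, hin, hi⟩ | hempty)
      · exact (Nat.sInf_le hi).trans hin
      · have : {i | z ∈ s i} = ∅ := Set.eq_empty_of_forall_notMem fun i hi => hempty ⟨i, hi⟩
        simp [this]
  rw [hpre]
  exact (MeasurableSet.biUnion (Set.to_countable _) fun i _ => hs i).union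
    (MeasurableSet.iUnion hs).compl

section SampleMode

variable {X : Type*} [MetricSpace X] [SecondCountableTopology X] [MeasurableSpace X]
  [BorelSpace X] (ν : Measure X) [SFinite ν] (h : ℝ) (K M : ℕ)

lemma measurable_densityScore (i : ℕ) : Measurable fun z => densityScore ν h K M z i := by
  have hball : Measurable fun x : X => ν (Metric.closedBall x h) :=
    measurable_measure_prodMk_left (s := {p : X × X | dist p.2 p.1 ≤ h})
      (measurableSet_le (by fun_prop) measurable_const)
  refine Measurable.div ?_ (hball.comp (measurable_pi_apply i))
  simp_rw [Finset.card_filter, Nat.cast_sum, Nat.cast_ite, Nat.cast_one, Nat.cast_zero]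
  exact Finset.measurable_sum _ fun j _ => Measurable.ite
    (measurableSet_le (by fun_prop) measurable_const) measurable_const measurable_const

lemma measurable_sampleMode : Measurable (sampleMode ν h K M) := by
  have hidx : Measurable fun z : ℕ → X => sInf {i | i ∈ Finset.Ioc K M ∧
      ∀ j ∈ Finset.Ioc K M, densityScore ν h K M z j ≤ densityScore ν h K M z i} := by
    refine measurable_sInf_setOf_mem (s := fun i => {z | i ∈ Finset.Ioc K M ∧
      ∀ j ∈ Finset.Ioc K M, densityScore ν h K M z j ≤ densityScore ν h K M z i}) fun i => ?_
    simp only [Set.ofPred_and, Set.ofPred_forall]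
    refine (MeasurableSet.const _).inter (.iInter fun j => .iInter fun _ => ?_)
    exact measurableSet_le (measurable_densityScore ν h K M j) (measurable_densityScore ν h K M i)
  have heval : Measurable fun p : (ℕ → X) × ℕ => p.1 p.2 :=
    measurable_from_prod_countable_left fun n => measurable_pi_apply n
  exact heval.comp (measurable_id.prodMk hidx)

lemma measurable_sampleMode_fst {Y : Type*} [MeasurableSpace Y] :
    Measurable fun z : ℕ → X × Y => sampleMode ν h K M fun i => (z i).1 :=
  (measurable_sampleMode ν h K M).comp (by fun_prop)

end SampleMode

section ChainLaw

variable {S T : Type*} [MeasurableSpace S] [MeasurableSpace T]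

lemma IsMarkovChain.map {κ : Kernel S S} {κ' : Kernel T T} {m : Measure (ℕ → S)}
    (hm : IsMarkovChain m κ) {f : S → T} (hf : Measurable f)
    (h : ∀ s, κ' (f s) = (κ s).map f) : IsMarkovChain (m.map fun z i => f (z i)) κ' := by
  intro n E hE B hB
  have hpath : Measurable fun (z : ℕ → S) i => f (z i) := by fun_prop
  have hpathn : Measurable[pathFiltration S n, pathFiltration T n] fun (z : ℕ → S) i => f (z i) :=
    measurable_pathFiltration_iff.2 fun i hi => hf.comp (measurable_pathFiltration_eval hi)
  have hE' : MeasurableSet E := (pathFiltration T).le n E hE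
  have hκ' : Measurable fun z : ℕ → T => κ' (z n) B :=
    (κ'.measurable_coe hB).comp (measurable_pi_apply n)
  have hEB : MeasurableSet (E ∩ {z | z (n + 1) ∈ B}) :=
    hE'.inter (hB.preimage (measurable_pi_apply (n + 1)))
  rw [Measure.map_apply hpath hEB, setLIntegral_map hE' hκ' hpath]
  simp only [h, Measure.map_apply hf hB]
  exact hm n _ (hpathn hE) _ (hf hB)

lemma map_chainLaw {μ : Measure S} [IsProbabilityMeasure μ] {κ : Kernel S S} [IsMarkovKernel κ]
    {κ' : Kernel T T} [IsMarkovKernel κ'] {f : S → T} (hf : Measurable f)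
    (h : ∀ s, κ' (f s) = (κ s).map f) :
    (chainLaw μ κ).map (fun z i => f (z i)) = chainLaw (μ.map f) κ' := by
  have hchain := ((isMarkovChain_chainLaw μ κ).map hf h).eq_chainLaw
  rwa [Measure.map_map (by fun_prop) (by fun_prop), show (fun z : ℕ → T => z 0) ∘
    (fun (z : ℕ → S) i => f (z i)) = f ∘ fun z => z 0 from rfl,
    ← Measure.map_map hf (by fun_prop), map_zero_chainLaw] at hchain

variable {P : Type*} [MeasurableSpace P]

-- The chain is run on `P × S`, where the parameter is a frozen coordinate of the state.
lemma measurable_chainLaw (μ : Kernel P S) [IsMarkovKernel μ] {κ : P → Kernel S S}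
    [∀ p, IsMarkovKernel (κ p)] (hκ : Measurable fun q : P × S => κ q.1 q.2) :
    Measurable fun p => chainLaw (μ p) (κ p) := by
  let κ₀ : Kernel (P × S) S := ⟨fun q => κ q.1 q.2, hκ⟩
  have : IsMarkovKernel κ₀ := ⟨fun q => inferInstanceAs (IsProbabilityMeasure (κ q.1 q.2))⟩
  let κ' : Kernel (P × S) (P × S) := Kernel.deterministic Prod.fst measurable_fst ×ₖ κ₀
  let R : Kernel P (ℕ → P × S) := pathKernel κ' ∘ₖ (Kernel.id ×ₖ μ)
  have hfrozen (p : P) : chainLaw (μ p) (κ p) = (R p).map fun z i => (z i).2 := by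
    have hstep (s : S) : κ' (p, s) = (κ p s).map (Prod.mk p) := by
      rw [Kernel.prod_apply, Kernel.deterministic_apply, Measure.dirac_prod]
      rfl
    have hR : R p = (chainLaw (μ p) (κ p)).map fun z i => (p, z i) := by
      rw [map_chainLaw measurable_prodMk_left hstep, chainLaw_eq_bind, Kernel.comp_apply,
        Kernel.prod_apply, Kernel.id_apply, Measure.dirac_prod]
    rw [hR, Measure.map_map (by fun_prop) (by fun_prop)]
    exact Measure.map_id.symm
  simp_rw [hfrozen]
  exact (Measure.measurable_map _ (by fun_prop)).comp R.measurable

lemma measurable_mhKernel {Q : P → Kernel S S} [∀ p, IsMarkovKernel (Q p)]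
    (hQ : Measurable fun q : P × S => Q q.1 q.2) {α : P → S → S → ℝ≥0∞}
    (hα : Measurable fun r : (P × S) × S => α r.1.1 r.1.2 r.2) :
    Measurable fun q : P × S => mhKernel (Q q.1) (α q.1) q.2 := by
  let Q₀ : Kernel (P × S) S := ⟨fun q => Q q.1 q.2, hQ⟩
  have : IsMarkovKernel Q₀ := ⟨fun q => inferInstanceAs (IsProbabilityMeasure (Q q.1 q.2))⟩
  have hstay : Measurable fun q => ∫⁻ t, (1 - α q.1 q.2 t) ∂Q₀ q :=
    Measurable.lintegral_kernel_prod_right (measurable_const.sub hα)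
  have happly (q : P × S) : mhKernel (Q q.1) (α q.1) q.2 =
      Q₀.withDensity (fun q => α q.1 q.2) q +
        (∫⁻ t, (1 - α q.1 q.2 t) ∂Q₀ q) • Measure.dirac q.2 := by
    have hαq : Measurable (Function.uncurry (α q.1)) :=
      hα.comp (by fun_prop : Measurable fun r : S × S => ((q.1, r.1), r.2))
    rw [mhKernel_apply hαq, Kernel.withDensity_apply _ hα]
    rfl
  simp_rw [happly]
  refine Measure.measurable_of_measurable_coe _ fun C hC => ?_
  simp only [Measure.add_apply, Measure.smul_apply, smul_eq_mul]
  exact (Kernel.measurable_coe _ hC).add (hstay.mul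
    ((Measure.measurable_coe hC).comp (Measure.measurable_dirac.comp measurable_snd)))

end ChainLaw

section APS

instance {X Y : Type*} [MeasurableSpace X] [MeasurableSpace Y] (G : Kernel X X) [IsMarkovKernel G]
    (L : Kernel X Y) [IsMarkovKernel L] (u : X × Y → ℝ) (hu : Measurable u) (x₀ : X) :
    IsProbabilityMeasure (apsRun G L u hu x₀) := by
  unfold apsRun; infer_instance

variable {P X Y : Type*} [MeasurableSpace P] [MeasurableSpace X] [MeasurableSpace Y]
  (G : Kernel X X) [IsMarkovKernel G] {L : P → Kernel X Y} [∀ p, IsMarkovKernel (L p)]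

lemma measurable_apsProposal (hL : Measurable fun q : P × X => L q.1 q.2) :
    Measurable fun q : P × (X × Y) => apsProposal G (L q.1) q.2 := by
  let L₀ : Kernel (P × X) Y := ⟨fun q => L q.1 q.2, hL⟩
  have : IsMarkovKernel L₀ := ⟨fun q => inferInstanceAs (IsProbabilityMeasure (L q.1 q.2))⟩
  let Q₀ : Kernel (P × (X × Y)) (X × Y) := G.comap (fun q => q.2.1) (by fun_prop) ⊗ₖ
    L₀.comap (fun r : (P × (X × Y)) × X => (r.1.1, r.2)) (by fun_prop)
  have happly (q : P × (X × Y)) : apsProposal G (L q.1) q.2 = Q₀ q := by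
    rw [apsProposal_apply, Kernel.compProd_apply_eq_compProd_sectR, Kernel.comap_apply]
    rfl
  simp_rw [happly]
  exact Q₀.measurable

variable {u : P → X × Y → ℝ}

lemma measurable_apsKernel (hL : Measurable fun q : P × X => L q.1 q.2)
    (hu : Measurable (Function.uncurry u)) :
    Measurable fun q : P × (X × Y) =>
      apsKernel G (L q.1) (u q.1) (hu.of_uncurry_left) q.2 := by
  have hnew : Measurable fun r : (P × (X × Y)) × (X × Y) => u r.1.1 r.2 :=
    hu.comp (by fun_prop : Measurable fun r : (P × (X × Y)) × (X × Y) => (r.1.1, r.2))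
  have hold : Measurable fun r : (P × (X × Y)) × (X × Y) => u r.1.1 r.1.2 :=
    hu.comp (by fun_prop : Measurable fun r : (P × (X × Y)) × (X × Y) => r.1)
  have hα : Measurable fun r : (P × (X × Y)) × (X × Y) => apsAcceptance (u r.1.1) r.1.2 r.2 :=
    (measurable_const.min (hnew.div hold)).ennreal_ofReal
  exact measurable_mhKernel (Q := fun p => apsProposal G (L p)) (α := fun p => apsAcceptance (u p))
    (measurable_apsProposal G hL) hα

lemma measurable_apsRun (hL : Measurable fun q : P × X => L q.1 q.2)
    (hu : Measurable (Function.uncurry u)) (x₀ : X) :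
    Measurable fun p => apsRun G (L p) (u p) (hu.of_uncurry_left) x₀ := by
  let μ : Kernel P (X × Y) :=
    ⟨fun p => drawFrom (L p) x₀, by
      simp_rw [drawFrom, Kernel.prod_apply, Kernel.id_apply, Measure.dirac_prod]
      exact (Measure.measurable_map _ measurable_prodMk_left).comp
        (hL.comp measurable_prodMk_right)⟩
  have : IsMarkovKernel μ := ⟨fun p => inferInstanceAs (IsProbabilityMeasure (drawFrom (L p) x₀))⟩
  exact measurable_chainLaw μ (κ := fun p => apsKernel G (L p) (u p) hu.of_uncurry_left)
    (measurable_apsKernel G hL hu)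

end APS

end Measurability

section InnerSampler

variable {D A Θ Ω : Type*} [MeasurableSpace D] [MeasurableSpace A] [MeasurableSpace Θ]
  [MeasurableSpace Ω] {νA : Measure A} {νΘ : Measure Θ} [SFinite νA] [SFinite νΘ]
  (gA : CondDensity A νA) (PA : CondDensity (Ω × D × A) νΘ)
  (UA : Ω → A × Θ → ℝ) (hUA : Measurable (Function.uncurry UA))

/-- The law of the draws of the inner loop started from `a₀`, as a kernel in the Attacker's type
and the defense. -/
def innerRunKernel (a₀ : A) : Kernel (Ω × D) (ℕ → A × Θ) where
  toFun p := innerRun gA PA UA hUA p.1 p.2 a₀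
  measurable' := by
    have hL : Measurable fun q : (Ω × D) × A => attackerOutcomeKernel PA q.1.1 q.1.2 q.2 :=
      PA.kernel.measurable.comp
        (by fun_prop : Measurable fun q : (Ω × D) × A => (q.1.1, q.1.2, q.2))
    have hu : Measurable (Function.uncurry fun p : Ω × D => UA p.1) :=
      hUA.comp (by fun_prop : Measurable fun q : (Ω × D) × (A × Θ) => (q.1.1, q.2))
    exact measurable_apsRun gA.kernel (L := fun p : Ω × D => attackerOutcomeKernel PA p.1 p.2)
      hL hu a₀

instance (ω : Ω) (d : D) (a₀ : A) : IsProbabilityMeasure (innerRun gA PA UA hUA ω d a₀) :=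
  inferInstanceAs (IsProbabilityMeasure
    (apsRun gA.kernel (attackerOutcomeKernel PA ω d) (UA ω) hUA.of_uncurry_left a₀))

instance (a₀ : A) : IsMarkovKernel (innerRunKernel gA PA UA hUA a₀) :=
  ⟨fun p => inferInstanceAs (IsProbabilityMeasure (innerRun gA PA UA hUA p.1 p.2 a₀))⟩

variable (P : Measure Ω) [IsProbabilityMeasure P]

/-- The joint law of the Attacker's type and the draws of the inner loop, for the defense `d`. -/
def innerJoint (d : D) (a₀ : A) : Measure (Ω × (ℕ → A × Θ)) :=
  P ⊗ₘ (innerRunKernel gA PA UA hUA a₀).comap (fun ω => (ω, d)) (by fun_prop)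

instance (d : D) (a₀ : A) : IsProbabilityMeasure (innerJoint gA PA UA hUA P d a₀) := by
  unfold innerJoint; infer_instance

end InnerSampler

section SampleAttack

variable {D A Θ Ω : Type*} [MeasurableSpace D] [MetricSpace A] [SecondCountableTopology A]
  [MeasurableSpace A] [BorelSpace A] [MeasurableSpace Θ]
  [MeasurableSpace Ω] {νA : Measure A} {νΘ : Measure Θ} [SFinite νA] [SFinite νΘ]
  (gA : CondDensity A νA) (PA : CondDensity (Ω × D × A) νΘ)
  (UA : Ω → A × Θ → ℝ) (hUA : Measurable (Function.uncurry UA)) (P : Measure Ω)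
  [IsProbabilityMeasure P] (a₀ : A) (h : ℝ) (K M : ℕ)

lemma sampleAttack_eq_map_innerJoint (d : D) :
    sampleAttack P gA PA UA hUA d a₀ h K M = (innerJoint gA PA UA hUA P d a₀).map
      fun q => sampleMode νA h K M fun i => (q.2 i).1 := by
  have hmode := measurable_sampleMode_fst (Y := Θ) νA h K M
  change _ = (innerJoint gA PA UA hUA P d a₀).map
    ((fun z => sampleMode νA h K M fun i => (z i).1) ∘ Prod.snd)
  rw [← Measure.map_map hmode measurable_snd, ← Measure.snd, innerJoint, Measure.snd_compProd,
    Measure.map_comp _ _ hmode]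
  refine congrArg P.bind (funext fun ω => ?_)
  rw [Kernel.map_apply _ hmode]
  rfl

/-- The law of the attack returned by the inner sampler, as a kernel in the defense. -/
def sampleAttackKernel : Kernel D A where
  toFun d := sampleAttack P gA PA UA hUA d a₀ h K M
  measurable' := by
    have hmode := measurable_sampleMode_fst (Y := Θ) νA h K M
    have hmode' : Measurable fun q : Ω × (ℕ → A × Θ) => sampleMode νA h K M fun i => (q.2 i).1 :=
      hmode.comp measurable_snd
    refine Measure.measurable_of_measurable_coe _ fun C hC => ?_
    simp_rw [sampleAttack_eq_map_innerJoint, Measure.map_apply hmode' hC, innerJoint,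
      Measure.compProd_apply (hC.preimage hmode')]
    exact ((innerRunKernel gA PA UA hUA a₀).measurable_coe (hC.preimage hmode)).lintegral_prod_left'

instance : IsMarkovKernel (sampleAttackKernel gA PA UA hUA P a₀ h K M) := by
  refine ⟨fun d => ?_⟩
  change IsProbabilityMeasure (sampleAttack P gA PA UA hUA d a₀ h K M)
  rw [sampleAttack_eq_map_innerJoint]
  exact Measure.isProbabilityMeasure_map
    ((measurable_sampleMode_fst νA h K M).comp measurable_snd).aemeasurable

end SampleAttack

section Diagonal

lemma exists_tendsto_atTop_le (n : ℕ → ℕ) :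
    ∃ ψ : ℕ → ℕ, Tendsto ψ atTop atTop ∧ ∀ᶠ N in atTop, n (ψ N) ≤ N := by
  refine ⟨fun N => Nat.findGreatest (fun m => n m ≤ N) N, tendsto_atTop.2 fun m => ?_, ?_⟩
  · filter_upwards [eventually_ge_atTop (max m (n m))] with N hN
    exact Nat.le_findGreatest ((le_max_left _ _).trans hN) ((le_max_right _ _).trans hN)
  · filter_upwards [eventually_ge_atTop (n 0)] with N hN
    exact Nat.findGreatest_spec (P := fun m => n m ≤ N) (Nat.zero_le N) hN

variable {Z : Type*} [MeasurableSpace Z] {μ : Measure Z} [IsFiniteMeasure μ]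

lemma exists_measure_tail_lt {E : ℕ → ℕ → Set Z} (hE : ∀ k N, MeasurableSet (E k N))
    (H : ∀ᵐ z ∂μ, ∀ᶠ k in atTop, ∀ᶠ N in atTop, z ∉ E k N) (m : ℕ) {p : ℝ≥0∞} (hp : 0 < p) :
    ∃ k ≥ m, ∃ n, μ {z | ∃ N ≥ n, z ∈ E k N} < p := by
  let T (k n : ℕ) : Set Z := {z | ∃ N ≥ n, z ∈ E k N}
  let F (k : ℕ) : Set Z := {z | ∃ᶠ N in atTop, z ∈ E k N}
  have hT (k n : ℕ) : MeasurableSet (T k n) := by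
    have : T k n = ⋃ N ≥ n, E k N := by ext z; simp [T]
    exact this ▸ .biUnion (Set.to_countable _) fun N _ => hE k N
  have hF (k : ℕ) : MeasurableSet (F k) := by
    have : F k = ⋂ n, T k n := by ext z; simp [F, T, frequently_atTop]
    exact this ▸ .iInter (hT k)
  have hF0 : Tendsto (fun k => μ (F k)) atTop (𝓝 (μ ∅)) := by
    refine tendsto_measure_of_ae_tendsto_indicator_of_isFiniteMeasure atTop .empty hF ?_
    filter_upwards [H] with z hz
    filter_upwards [hz] with k hk
    exact iff_of_false (not_frequently.2 hk) (Set.notMem_empty z)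
  have hTF (k : ℕ) : Tendsto (fun n => μ (T k n)) atTop (𝓝 (μ (F k))) := by
    refine tendsto_measure_of_ae_tendsto_indicator_of_isFiniteMeasure atTop (hF k) (hT k)
      (ae_of_all _ fun z => ?_)
    by_cases hz : z ∈ F k
    · exact .of_forall fun n => iff_of_true (frequently_atTop.1 hz n) hz
    · obtain ⟨n₀, hn₀⟩ := eventually_atTop.1 (not_frequently.1 hz)
      filter_upwards [eventually_ge_atTop n₀] with n hn
      exact iff_of_false (fun ⟨N, hN, hmem⟩ => hn₀ N (hn.trans hN) hmem) hz
  rw [measure_empty] at hF0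
  obtain ⟨k, hk, hkm⟩ := ((hF0.eventually_lt_const hp).and (eventually_ge_atTop m)).exists
  exact ⟨k, hkm, ((hTF k).eventually_lt_const hk).exists⟩

lemma exists_diagonal_ae_eventually_lt {f : ℕ → ℕ → Z → ℝ} (hf : ∀ k N, Measurable (f k N))
    (H : ∀ ε > 0, ∀ᵐ z ∂μ, ∀ᶠ k in atTop, ∀ᶠ N in atTop, f k N z < ε) :
    ∃ φ : ℕ → ℕ, Tendsto φ atTop atTop ∧ ∀ᵐ z ∂μ, ∀ ε > 0, ∀ᶠ N in atTop, f (φ N) N z < ε := by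
  obtain ⟨p, hp, hsum⟩ := ENNReal.exists_pos_sum_of_countable one_ne_zero ℕ
  have hbad (m : ℕ) : ∃ k ≥ m, ∃ n, μ {z | ∃ N ≥ n, z ∈ {z | 1 / ((m : ℝ) + 1) ≤ f k N z}} < p m :=
    exists_measure_tail_lt (fun k N => measurableSet_le measurable_const (hf k N))
      (by simpa only [Set.mem_ofPred_eq, not_le] using H _ Nat.one_div_pos_of_nat) m
      (ENNReal.coe_pos.2 (hp m))
  choose k hk n hn using hbad
  obtain ⟨ψ, hψ, hψn⟩ := exists_tendsto_atTop_le n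
  refine ⟨k ∘ ψ, (tendsto_atTop_mono hk tendsto_id).comp hψ, ?_⟩
  -- Borel-Cantelli for the bad events of the `m`-th tolerance `1 / (m + 1)`.
  have hfin : ∑' m, μ {z | ∃ N ≥ n m, 1 / ((m : ℝ) + 1) ≤ f (k m) N z} ≠ ∞ :=
    ne_top_of_le_ne_top (hsum.trans ENNReal.one_lt_top).ne
      (ENNReal.tsum_le_tsum fun m => (hn m).le)
  filter_upwards [ae_eventually_notMem hfin] with z hz ε hε
  have hsmall : ∀ᶠ m : ℕ in atTop, 1 / ((m : ℝ) + 1) < ε :=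
    tendsto_one_div_add_atTop_nhds_zero_nat.eventually_lt_const hε
  filter_upwards [hψ.eventually hz, hψn, hψ.eventually hsmall] with N hgood hN hlt
  by_contra! hle
  exact hgood ⟨N, hN, hlt.le.trans hle⟩

end Diagonal

section Bandwidth

variable {Z : Type*} [MeasurableSpace Z] {μ : Measure Z}

lemma ae_eventually_one_div_of_forall_ae {p : ℝ → Z → Prop} {h₀ : ℝ} (hh₀ : 0 < h₀)
    (H : ∀ h, 0 < h → h < h₀ → ∀ᵐ z ∂μ, p h z) :
    ∀ᵐ z ∂μ, ∀ᶠ k : ℕ in atTop, p (1 / ((k : ℝ) + 1)) z := by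
  have hsmall : ∀ᶠ k : ℕ in atTop, 1 / ((k : ℝ) + 1) < h₀ :=
    tendsto_one_div_add_atTop_nhds_zero_nat.eventually_lt_const hh₀
  have hall : ∀ᵐ z ∂μ, ∀ k : ℕ, 1 / ((k : ℝ) + 1) < h₀ → p (1 / ((k : ℝ) + 1)) z := by
    simp_rw [ae_all_iff]
    exact fun k => H _ Nat.one_div_pos_of_nat
  filter_upwards [hall] with z hz
  exact hsmall.mono hz

variable {S : Type*} [MetricSpace S] [SecondCountableTopology S] [MeasurableSpace S]
  [BorelSpace S]

lemma exists_bandwidth_ae_tendsto [IsFiniteMeasure μ] {mode : ℝ → ℕ → Z → S}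
    (hmode : ∀ h N, Measurable (mode h N)) {x : Z → S} (hx : Measurable x)
    (H : ∀ ε > 0, ∀ᵐ z ∂μ, ∀ᶠ k : ℕ in atTop, ∀ᶠ N in atTop,
      dist (mode (1 / ((k : ℝ) + 1)) N z) (x z) < ε) :
    ∃ h : ℕ → ℝ, (∀ N, 0 < h N) ∧ Tendsto h atTop (𝓝 0) ∧
      ∀ᵐ z ∂μ, Tendsto (fun N => mode (h N) N z) atTop (𝓝 (x z)) := by
  obtain ⟨φ, hφ, hconv⟩ := exists_diagonal_ae_eventually_lt
    (f := fun k N z => dist (mode (1 / ((k : ℝ) + 1)) N z) (x z))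
    (fun k N => (hmode _ _).dist hx) H
  refine ⟨fun N => 1 / ((φ N : ℝ) + 1), fun N => Nat.one_div_pos_of_nat,
    tendsto_one_div_add_atTop_nhds_zero_nat.comp hφ, ?_⟩
  filter_upwards [hconv] with z hz
  exact Metric.tendsto_nhds.2 hz

end Bandwidth

section Targets

section WithDensity

variable {X Y : Type*} [MeasurableSpace X] [MeasurableSpace Y] {κ L : Kernel X Y}
  [IsSFiniteKernel κ] {p : X → Y → ℝ} (hp : Measurable (Function.uncurry p))
  (hp0 : ∀ x y, 0 ≤ p x y) (hL : L = κ.withDensity fun x y => ENNReal.ofReal (p x y))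
  {u : X × Y → ℝ} (hu : Measurable u)

include hp hp0 hL hu

lemma apsTarget_eq_withDensity [IsSFiniteKernel L] (ν : Measure X) [SFinite ν] :
    apsTarget ν L u =
      (ν ⊗ₘ κ).withDensity fun s => ENNReal.ofReal (u s * p s.1 s.2) := by
  have hp' : Measurable fun s : X × Y => ENNReal.ofReal (p s.1 s.2) := hp.ennreal_ofReal
  subst hL
  rw [apsTarget, Measure.compProd_withDensity hp', ← withDensity_mul _ hp' hu.ennreal_ofReal]
  congr 1 with s
  rw [Pi.mul_apply, ENNReal.ofReal_mul' (hp0 _ _), mul_comm]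

lemma lintegral_eq_of_withDensity (x : X) :
    ∫⁻ y, ENNReal.ofReal (u (x, y)) ∂L x = ∫⁻ y, ENNReal.ofReal (u (x, y) * p x y) ∂κ x := by
  rw [hL, Kernel.lintegral_withDensity _ hp.ennreal_ofReal _ (by fun_prop)]
  simp_rw [ENNReal.ofReal_mul' (hp0 _ _), mul_comm]

end WithDensity

variable {D A Θ Ω : Type*} [MeasurableSpace D] [MeasurableSpace A] [MeasurableSpace Θ]
  [MeasurableSpace Ω] {νΘ : Measure Θ} [SFinite νΘ]

section Attacker

variable (PA : CondDensity (Ω × D × A) νΘ) (ω : Ω) (d : D)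

omit [SFinite νΘ] in
lemma measurable_attackerDensity : Measurable (Function.uncurry fun a => PA.p (ω, d, a)) :=
  PA.measurable_p.comp (by fun_prop : Measurable fun r : A × Θ => ((ω, d, r.1), r.2))

lemma attackerOutcomeKernel_eq_withDensity : attackerOutcomeKernel PA ω d =
    (Kernel.const A νΘ).withDensity fun a θ => ENNReal.ofReal (PA.p (ω, d, a) θ) := by
  ext1 a
  rw [attackerOutcomeKernel, Kernel.comap_apply, CondDensity.kernel_apply,
    Kernel.withDensity_apply _ (measurable_attackerDensity PA ω d).ennreal_ofReal,
    Kernel.const_apply]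

variable {u : A × Θ → ℝ} (hu : Measurable u)
include hu

lemma apsTarget_attackerOutcomeKernel (νA : Measure A) [SFinite νA] :
    apsTarget νA (attackerOutcomeKernel PA ω d) u =
      (νA.prod νΘ).withDensity fun s => ENNReal.ofReal (u s * PA.p (ω, d, s.1) s.2) := by
  rw [apsTarget_eq_withDensity (measurable_attackerDensity PA ω d) (fun _ _ => PA.nonneg _ _)
    (attackerOutcomeKernel_eq_withDensity PA ω d) hu, Measure.compProd_const]

lemma attackerExpectedUtility_eq_lintegral :
    attackerExpectedUtility νΘ (fun a θ => u (a, θ)) (fun a => PA.p (ω, d, a)) =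
      fun a => ∫⁻ θ, ENNReal.ofReal (u (a, θ)) ∂attackerOutcomeKernel PA ω d a := by
  funext a
  rw [lintegral_eq_of_withDensity (measurable_attackerDensity PA ω d) (fun _ _ => PA.nonneg _ _)
    (attackerOutcomeKernel_eq_withDensity PA ω d) hu]
  rfl

end Attacker

section Defender

variable (pD : CondDensity (D × A) νΘ) (q : Kernel D A)

omit [SFinite νΘ] in
lemma measurable_defenderDensity :
    Measurable (Function.uncurry fun d (y : A × Θ) => pD.p (d, y.1) y.2) :=
  pD.measurable_p.comp (by fun_prop : Measurable fun r : D × A × Θ => ((r.1, r.2.1), r.2.2))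

variable [IsMarkovKernel q]

lemma compProd_kernel_eq_withDensity : q ⊗ₖ pD.kernel =
    (q ×ₖ Kernel.const D νΘ).withDensity fun d y => ENNReal.ofReal (pD.p (d, y.1) y.2) := by
  ext d C hC
  have hd : Measurable fun y : A × Θ => ENNReal.ofReal (pD.p (d, y.1) y.2) :=
    (measurable_defenderDensity pD).of_uncurry_left.ennreal_ofReal
  rw [Kernel.withDensity_apply' _ (measurable_defenderDensity pD).ennreal_ofReal,
    ← lintegral_indicator hC, Kernel.prod_apply, Kernel.const_apply,
    lintegral_prod _ (hd.indicator hC).aemeasurable, Kernel.compProd_apply hC]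
  refine lintegral_congr fun a => ?_
  rw [CondDensity.kernel_apply, withDensity_apply _ (hC.preimage measurable_prodMk_left),
    ← lintegral_indicator (hC.preimage measurable_prodMk_left)]
  rfl

variable {uD : D × Θ → ℝ} (huD : Measurable uD)
include huD

lemma apsTarget_compProd_kernel (νD : Measure D) [SFinite νD] :
    apsTarget νD (q ⊗ₖ pD.kernel) (fun s => uD (s.1, s.2.2)) =
      (tripleMeasure νD νΘ q).withDensity fun s =>
        ENNReal.ofReal (uD (s.1, s.2.2) * pD.p (s.1, s.2.1) s.2.2) :=
  apsTarget_eq_withDensity (measurable_defenderDensity pD) (fun _ _ => pD.nonneg _ _)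
    (compProd_kernel_eq_withDensity pD q) (by fun_prop) νD

lemma defenderExpectedUtility_eq_lintegral :
    defenderExpectedUtility uD pD q =
      fun d => ∫⁻ y, ENNReal.ofReal (uD (d, y.2)) ∂(q ⊗ₖ pD.kernel) d := by
  funext d
  have hd : Measurable fun y : A × Θ => pD.p (d, y.1) y.2 :=
    (measurable_defenderDensity pD).of_uncurry_left
  rw [lintegral_eq_of_withDensity (measurable_defenderDensity pD) (fun _ _ => pD.nonneg _ _)
    (compProd_kernel_eq_withDensity pD q) (u := fun s => uD (s.1, s.2.2)) (by fun_prop),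
    Kernel.prod_apply, Kernel.const_apply, lintegral_prod _ (by fun_prop)]
  rfl

end Defender

end Targets

section Stationarity

variable {D A Θ Ω : Type*} [MeasurableSpace D] [MeasurableSpace A] [MeasurableSpace Θ]
  [MeasurableSpace Ω] {νD : Measure D} {νA : Measure A} {νΘ : Measure Θ} [SFinite νΘ]

section Attacker

variable [SFinite νA] (PA : CondDensity (Ω × D × A) νΘ) {ω : Ω} {d : D}

lemma apsTarget_attackerOutcomeKernel_univ_ne_top {u : A × Θ → ℝ} (hu : Measurable u)
    (hint : Integrable (fun s : A × Θ => u s * PA.p (ω, d, s.1) s.2) (νA.prod νΘ)) :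
    apsTarget νA (attackerOutcomeKernel PA ω d) u Set.univ ≠ ∞ := by
  rw [apsTarget_attackerOutcomeKernel PA ω d hu, withDensity_apply _ .univ, setLIntegral_univ]
  exact hint.lintegral_lt_top.ne

variable {UA : Ω → A × Θ → ℝ} (hUA : Measurable (Function.uncurry UA))
  (hpos : ∀ a θ, 0 < UA ω (a, θ))

include hUA in
lemma attackerTarget_eq_normalized_apsTarget :
    attackerTarget νA νΘ (fun a θ => UA ω (a, θ)) (fun a => PA.p (ω, d, a)) =
      normalized (apsTarget νA (attackerOutcomeKernel PA ω d) (UA ω)) :=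
  congrArg normalized (apsTarget_attackerOutcomeKernel PA ω d hUA.of_uncurry_left νA).symm

include hUA hpos in
theorem isProbabilityMeasure_attackerTarget (hνA : νA ≠ 0)
    (hint : Integrable (fun s : A × Θ => UA ω s * PA.p (ω, d, s.1) s.2) (νA.prod νΘ)) :
    IsProbabilityMeasure
      (attackerTarget νA νΘ (fun a θ => UA ω (a, θ)) (fun a => PA.p (ω, d, a))) := by
  rw [attackerTarget_eq_normalized_apsTarget PA hUA]
  exact isProbabilityMeasure_normalized
    (apsTarget_ne_zero _ hUA.of_uncurry_left hνA fun s => hpos s.1 s.2)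
    (apsTarget_attackerOutcomeKernel_univ_ne_top PA hUA.of_uncurry_left hint)

include hpos in
theorem invariant_innerKernel (gA : CondDensity A νA) (hgA : gA.IsSymmetric) :
    (innerKernel gA PA UA hUA ω d).Invariant
      (attackerTarget νA νΘ (fun a θ => UA ω (a, θ)) (fun a => PA.p (ω, d, a))) := by
  rw [attackerTarget_eq_normalized_apsTarget PA hUA]
  exact invariant_apsKernel _ hUA.of_uncurry_left gA hgA fun s => hpos s.1 s.2

end Attacker

section Defender

variable [SFinite νD] (pD : CondDensity (D × A) νΘ) (q : Kernel D A) [IsMarkovKernel q]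
  {uD : D × Θ → ℝ} (huD : Measurable uD) (hpos : ∀ d θ, 0 < uD (d, θ))

include huD

lemma apsTarget_compProd_kernel_univ_ne_top
    (hint : Integrable (fun s : D × A × Θ => uD (s.1, s.2.2) * pD.p (s.1, s.2.1) s.2.2)
      (tripleMeasure νD νΘ q)) :
    apsTarget νD (q ⊗ₖ pD.kernel) (fun s => uD (s.1, s.2.2)) Set.univ ≠ ∞ := by
  rw [apsTarget_compProd_kernel pD q huD, withDensity_apply _ .univ, setLIntegral_univ]
  exact hint.lintegral_lt_top.ne

lemma defenderTarget_eq_normalized_apsTarget :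
    defenderTarget νD uD pD q =
      normalized (apsTarget νD (q ⊗ₖ pD.kernel) fun s => uD (s.1, s.2.2)) :=
  congrArg normalized (apsTarget_compProd_kernel pD q huD νD).symm

include hpos

theorem isProbabilityMeasure_defenderTarget (hνD : νD ≠ 0)
    (hint : Integrable (fun s : D × A × Θ => uD (s.1, s.2.2) * pD.p (s.1, s.2.1) s.2.2)
      (tripleMeasure νD νΘ q)) :
    IsProbabilityMeasure (defenderTarget νD uD pD q) := by
  rw [defenderTarget_eq_normalized_apsTarget pD q huD]
  exact isProbabilityMeasure_normalized
    (apsTarget_ne_zero _ (by fun_prop) hνD fun s => hpos s.1 s.2.2)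
    (apsTarget_compProd_kernel_univ_ne_top pD q huD hint)

theorem invariant_outerKernel (gD : CondDensity D νD) (hgD : gD.IsSymmetric) :
    (outerKernel gD pD uD huD q).Invariant (defenderTarget νD uD pD q) := by
  rw [defenderTarget_eq_normalized_apsTarget pD q huD]
  exact invariant_apsKernel _ (by fun_prop) gD hgD fun s => hpos s.1 s.2.2

end Defender

end Stationarity

lemma measurableSet_setOf_eventually_atTop {Z : Type*} [MeasurableSpace Z] {p : ℕ → Z → Prop}
    (hp : ∀ n, MeasurableSet {z | p n z}) : MeasurableSet {z | ∀ᶠ n in atTop, p n z} := by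
  have : {z | ∀ᶠ n in atTop, p n z} = liminf (fun n => {z | p n z}) atTop := by
    ext z
    exact mem_liminf_iff_eventually_mem.symm
  exact this ▸ MeasurableSet.measurableSet_liminf hp

section InnerConsistency

variable {D A Θ Ω : Type*} [MeasurableSpace D] [MetricSpace A] [SecondCountableTopology A]
  [MeasurableSpace A] [BorelSpace A] [MeasurableSpace Θ] [MeasurableSpace Ω] {νA : Measure A}
  [SFinite νA] {νΘ : Measure Θ} [SFinite νΘ] (gA : CondDensity A νA)
  (PA : CondDensity (Ω × D × A) νΘ) {UA : Ω → A × Θ → ℝ} (hUA : Measurable (Function.uncurry UA))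
  {d : D}

theorem exists_forall_ae_dist_sampleMode_innerRun_lt {r : ℝ} (hνA : HasRegularWindows νA r)
    (hr : 0 < r) (hgA : gA.IsSymmetric) (hirr : Kernel.IsIrreducible νA gA.kernel) {ω : Ω}
    (hpos : ∀ a θ, 0 < UA ω (a, θ))
    (hint : Integrable (fun s : A × Θ => UA ω s * PA.p (ω, d, s.1) s.2) (νA.prod νΘ)) {x : A}
    (hx : IsWellSeparatedArgmax
      (attackerExpectedUtility νΘ (fun a θ => UA ω (a, θ)) (fun a => PA.p (ω, d, a))) x)
    {ε : ℝ} (hε : 0 < ε) :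
    ∃ h₀ > 0, ∀ h, 0 < h → h < h₀ → ∀ (a₀ : A) (K : ℕ),
      ∀ᵐ z ∂(innerRun gA PA UA hUA ω d a₀), ∀ᶠ M in atTop,
        dist (sampleMode νA h K M fun i => (z i).1) x < ε := by
  have hu : Measurable (UA ω) := hUA.of_uncurry_left
  rw [attackerExpectedUtility_eq_lintegral PA ω d hu] at hx
  exact exists_forall_ae_dist_sampleMode_apsRun_lt hνA hr (attackerOutcomeKernel PA ω d) hu gA hgA
    (fun s => hpos s.1 s.2) hirr (apsTarget_attackerOutcomeKernel_univ_ne_top PA hu hint) hx hε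

variable (P : Measure Ω) {x : Ω → A} (hx : Measurable x) (a₀ : A) (K : ℕ)
  (H : ∀ᵐ ω ∂P, ∀ ε > 0, ∃ h₀ > 0, ∀ h, 0 < h → h < h₀ → ∀ (a₀ : A) (K : ℕ),
    ∀ᵐ z ∂(innerRun gA PA UA hUA ω d a₀), ∀ᶠ M in atTop,
      dist (sampleMode νA h K M fun i => (z i).1) (x ω) < ε)

include hx H

lemma ae_innerJoint_eventually_dist_sampleMode_lt {ε : ℝ} (hε : 0 < ε) :
    ∀ᵐ q ∂(innerJoint gA PA UA hUA P d a₀), ∀ᶠ k : ℕ in atTop, ∀ᶠ M in atTop,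
      dist (sampleMode νA (1 / ((k : ℝ) + 1)) K M fun i => (q.2 i).1) (x q.1) < ε := by
  have hdist (h : ℝ) (M : ℕ) : Measurable fun q : Ω × (ℕ → A × Θ) =>
      dist (sampleMode νA h K M fun i => (q.2 i).1) (x q.1) :=
    ((measurable_sampleMode_fst νA h K M).comp measurable_snd).dist (hx.comp measurable_fst)
  have hmeas : MeasurableSet {q : Ω × (ℕ → A × Θ) | ∀ᶠ k : ℕ in atTop, ∀ᶠ M in atTop,
      dist (sampleMode νA (1 / ((k : ℝ) + 1)) K M fun i => (q.2 i).1) (x q.1) < ε} :=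
    measurableSet_setOf_eventually_atTop fun k => measurableSet_setOf_eventually_atTop fun M =>
      measurableSet_lt (hdist _ M) measurable_const
  refine Measure.ae_compProd_of_ae_ae hmeas ?_
  filter_upwards [H] with ω hω
  obtain ⟨h₀, hh₀, hmode⟩ := hω ε hε
  exact ae_eventually_one_div_of_forall_ae hh₀ fun h h0 hlt => hmode h h0 hlt a₀ K

theorem exists_bandwidth_tendsto_sampleAttack [IsProbabilityMeasure P] :
    ∃ h : ℕ → ℝ, (∀ M, 0 < h M) ∧ Tendsto h atTop (𝓝 0) ∧
      (∀ M, IsProbabilityMeasure (sampleAttack P gA PA UA hUA d a₀ (h M) K M)) ∧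
      ∀ f : A →ᵇ ℝ,
        Tendsto (fun M => ∫ a, f a ∂(sampleAttack P gA PA UA hUA d a₀ (h M) K M)) atTop
          (𝓝 (∫ a, f a ∂(P.map x))) := by
  have hmode (h : ℝ) (M : ℕ) : Measurable fun q : Ω × (ℕ → A × Θ) =>
      sampleMode νA h K M fun i => (q.2 i).1 :=
    (measurable_sampleMode_fst νA h K M).comp measurable_snd
  have hx' : Measurable fun q : Ω × (ℕ → A × Θ) => x q.1 := hx.comp measurable_fst
  obtain ⟨h, h0, hlim, hconv⟩ := exists_bandwidth_ae_tendsto hmode hx' fun ε hε =>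
    ae_innerJoint_eventually_dist_sampleMode_lt gA PA hUA P hx a₀ K H hε
  refine ⟨h, h0, hlim, fun M => inferInstanceAs
    (IsProbabilityMeasure (sampleAttackKernel gA PA UA hUA P a₀ (h M) K M d)), fun f => ?_⟩
  have hlaw : (innerJoint gA PA UA hUA P d a₀).map (fun q => x q.1) = P.map x := by
    have hfst : (innerJoint gA PA UA hUA P d a₀).map Prod.fst = P := Measure.fst_compProd _ _
    conv_rhs => rw [← hfst, Measure.map_map hx measurable_fst]
    rfl
  have hdistr := tendstoInDistribution_of_ae_tendsto
    (fun M => (hmode (h M) M).aemeasurable) hx'.aemeasurable hconv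
  have hint := ProbabilityMeasure.tendsto_iff_forall_integral_tendsto.1 hdistr.tendsto f
  simp_rw [sampleAttack_eq_map_innerJoint, ← hlaw]
  exact hint

end InnerConsistency

section OuterConsistency

variable {D A Θ : Type*} [MetricSpace D] [SecondCountableTopology D] [MeasurableSpace D]
  [BorelSpace D] [MeasurableSpace A] [MeasurableSpace Θ] {νD : Measure D} [SFinite νD]
  {νΘ : Measure Θ} [SFinite νΘ] (gD : CondDensity D νD) (pD : CondDensity (D × A) νΘ)
  {uD : D × Θ → ℝ} (huD : Measurable uD) (q : Kernel D A) [IsMarkovKernel q] {x : D}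

theorem exists_forall_ae_dist_sampleMode_outerRun_lt {r : ℝ} (hνD : HasRegularWindows νD r)
    (hr : 0 < r) (hgD : gD.IsSymmetric) (hirr : Kernel.IsIrreducible νD gD.kernel)
    (hpos : ∀ d θ, 0 < uD (d, θ))
    (hint : Integrable (fun s : D × A × Θ => uD (s.1, s.2.2) * pD.p (s.1, s.2.1) s.2.2)
      (tripleMeasure νD νΘ q))
    (hx : IsWellSeparatedArgmax (defenderExpectedUtility uD pD q) x) {ε : ℝ} (hε : 0 < ε) :
    ∃ h₀ > 0, ∀ h, 0 < h → h < h₀ → ∀ (d₀ : D) (R : ℕ),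
      ∀ᵐ z ∂(outerRun gD pD uD huD q d₀), ∀ᶠ N in atTop,
        dist (sampleMode νD h R N fun i => (z i).1) x < ε := by
  rw [defenderExpectedUtility_eq_lintegral pD q huD] at hx
  exact exists_forall_ae_dist_sampleMode_apsRun_lt hνD hr (q ⊗ₖ pD.kernel)
    (u := fun s => uD (s.1, s.2.2)) (by fun_prop) gD hgD (fun s => hpos s.1 s.2.2) hirr
    (apsTarget_compProd_kernel_univ_ne_top pD q huD hint) hx hε

theorem exists_bandwidth_tendsto_sampleMode_outerRun
    (H : ∀ ε > 0, ∃ h₀ > 0, ∀ h, 0 < h → h < h₀ → ∀ (d₀ : D) (R : ℕ),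
      ∀ᵐ z ∂(outerRun gD pD uD huD q d₀), ∀ᶠ N in atTop,
        dist (sampleMode νD h R N fun i => (z i).1) x < ε) (d₀ : D) (R : ℕ) :
    ∃ h : ℕ → ℝ, (∀ N, 0 < h N) ∧ Tendsto h atTop (𝓝 0) ∧
      ∀ᵐ z ∂(outerRun gD pD uD huD q d₀),
        Tendsto (fun N => sampleMode νD (h N) R N fun i => (z i).1) atTop (𝓝 x) := by
  have : IsProbabilityMeasure (outerRun gD pD uD huD q d₀) := by
    unfold outerRun; infer_instance
  refine exists_bandwidth_ae_tendsto (x := fun _ => x)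
    (fun h N => measurable_sampleMode_fst νD h R N) measurable_const fun ε hε => ?_
  obtain ⟨h₀, hh₀, hmode⟩ := H ε hε
  exact ae_eventually_one_div_of_forall_ae hh₀ fun h h0 hlt => hmode h h0 hlt d₀ R

end OuterConsistency

end

theorem proposition2_general {D A Θ Ω : Type*}
    [MetricSpace D] [SecondCountableTopology D] [MeasurableSpace D] [BorelSpace D] [Nonempty D]
    [MetricSpace A] [SecondCountableTopology A] [MeasurableSpace A] [BorelSpace A]
    [MeasurableSpace Θ] [MeasurableSpace Ω]
    (νD : Measure D) [SFinite νD] {rD : ℝ} (hνD : HasRegularWindows νD rD) (hrD : 0 < rD)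
    (νA : Measure A) [SFinite νA] {rA : ℝ} (hνA : HasRegularWindows νA rA) (hrA : 0 < rA)
    (νΘ : Measure Θ) [SFinite νΘ]
    (P : Measure Ω) [IsProbabilityMeasure P]
    (uD : D × Θ → ℝ) (huD : Measurable uD) (pD : CondDensity (D × A) νΘ)
    (UA : Ω → A × Θ → ℝ) (hUA : Measurable (Function.uncurry UA))
    (PA : CondDensity (Ω × D × A) νΘ)
    (Astar : D → Ω → A) (hA : Measurable (Function.uncurry Astar))
    (_hAstar : ∀ d, ∀ᵐ ω ∂P, ∀ a,
      attackerExpectedUtility νΘ (fun a θ => UA ω (a, θ)) (fun a => PA.p (ω, d, a)) a ≤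
        attackerExpectedUtility νΘ (fun a θ => UA ω (a, θ)) (fun a => PA.p (ω, d, a)) (Astar d ω))
    (gD : CondDensity D νD) (hgD : gD.IsSymmetric)
    (gA : CondDensity A νA) (hgA : gA.IsSymmetric)
    (huD_pos : ∀ d θ, 0 < uD (d, θ)) (hUA_pos : ∀ᵐ ω ∂P, ∀ a θ, 0 < UA ω (a, θ))
    (hD_int : Integrable (fun s : D × A × Θ => uD (s.1, s.2.2) * pD.p (s.1, s.2.1) s.2.2)
      (tripleMeasure νD νΘ (attackDist P Astar hA)))
    (hA_int : ∀ d, ∀ᵐ ω ∂P, Integrable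
      (fun s : A × Θ => UA ω (s.1, s.2) * PA.p (ω, d, s.1) s.2) (νA.prod νΘ)) :
    (∀ d, ∀ᵐ ω ∂P,
      IsProbabilityMeasure
        (attackerTarget νA νΘ (fun a θ => UA ω (a, θ)) (fun a => PA.p (ω, d, a))) ∧
      (innerKernel gA PA UA hUA ω d).Invariant
        (attackerTarget νA νΘ (fun a θ => UA ω (a, θ)) (fun a => PA.p (ω, d, a)))) ∧
    (IsProbabilityMeasure (defenderTarget νD uD pD (attackDist P Astar hA)) ∧
      (outerKernel gD pD uD huD (attackDist P Astar hA)).Invariant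
        (defenderTarget νD uD pD (attackDist P Astar hA)) ∧
      (∀ (a₀ : A) (h : ℝ) (K M : ℕ), ∃ (q : Kernel D A) (_ : IsMarkovKernel q),
        (∀ d, q d = sampleAttack P gA PA UA hUA d a₀ h K M) ∧
        (Integrable (fun s : D × A × Θ => uD (s.1, s.2.2) * pD.p (s.1, s.2.1) s.2.2)
            (tripleMeasure νD νΘ q) →
          IsProbabilityMeasure (defenderTarget νD uD pD q) ∧
          (outerKernel gD pD uD huD q).Invariant (defenderTarget νD uD pD q)))) ∧
    (Kernel.IsIrreducible νA gA.kernel →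
      ∀ d, (∀ᵐ ω ∂P, IsWellSeparatedArgmax
        (attackerExpectedUtility νΘ (fun a θ => UA ω (a, θ)) (fun a => PA.p (ω, d, a)))
        (Astar d ω)) →
      (∀ᵐ ω ∂P, ∀ ε > 0, ∃ h₀ > 0, ∀ h, 0 < h → h < h₀ → ∀ (a₀ : A) (K : ℕ),
        ∀ᵐ z ∂(innerRun gA PA UA hUA ω d a₀), ∀ᶠ M in atTop,
          dist (sampleMode νA h K M fun i => (z i).1) (Astar d ω) < ε) ∧
      (∀ (a₀ : A) (K : ℕ), ∃ h : ℕ → ℝ, (∀ M, 0 < h M) ∧ Tendsto h atTop (𝓝 0) ∧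
        (∀ M, IsProbabilityMeasure (sampleAttack P gA PA UA hUA d a₀ (h M) K M)) ∧
        ∀ f : A →ᵇ ℝ,
          Tendsto (fun M => ∫ a, f a ∂(sampleAttack P gA PA UA hUA d a₀ (h M) K M)) atTop
            (𝓝 (∫ a, f a ∂(attackDist P Astar hA d))))) ∧
    (Kernel.IsIrreducible νD gD.kernel →
      ∀ dstar, IsWellSeparatedArgmax
        (defenderExpectedUtility uD pD (attackDist P Astar hA)) dstar →
      (∀ ε > 0, ∃ h₀ > 0, ∀ h, 0 < h → h < h₀ → ∀ (d₀ : D) (R : ℕ),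
        ∀ᵐ z ∂(outerRun gD pD uD huD (attackDist P Astar hA) d₀), ∀ᶠ N in atTop,
          dist (sampleMode νD h R N fun i => (z i).1) dstar < ε) ∧
      (∀ (d₀ : D) (R : ℕ), ∃ h : ℕ → ℝ, (∀ N, 0 < h N) ∧ Tendsto h atTop (𝓝 0) ∧
        ∀ᵐ z ∂(outerRun gD pD uD huD (attackDist P Astar hA) d₀),
          Tendsto (fun N => sampleMode νD (h N) R N fun i => (z i).1) atTop (𝓝 dstar))) := by
  refine ⟨fun d => ?_,
    ⟨isProbabilityMeasure_defenderTarget pD _ huD huD_pos (hνD.ne_zero hrD) hD_int,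
      invariant_outerKernel pD _ huD huD_pos gD hgD, fun a₀ h K M => ?_⟩, fun hirr d hwell => ?_,
    fun hirr dstar hwell => ?_⟩
  · filter_upwards [hUA_pos, hA_int d] with ω hpos hint
    have : Nonempty A := ⟨Astar d ω⟩
    exact ⟨isProbabilityMeasure_attackerTarget PA hUA hpos (hνA.ne_zero hrA) hint,
      invariant_innerKernel PA hUA hpos gA hgA⟩
  · exact ⟨sampleAttackKernel gA PA UA hUA P a₀ h K M, inferInstance, fun _ => rfl, fun hint =>
      ⟨isProbabilityMeasure_defenderTarget pD _ huD huD_pos (hνD.ne_zero hrD) hint,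
        invariant_outerKernel pD _ huD huD_pos gD hgD⟩⟩
  · have consistent : ∀ᵐ ω ∂P, ∀ ε > 0, ∃ h₀ > 0, ∀ h, 0 < h → h < h₀ → ∀ (a₀ : A) (K : ℕ),
        ∀ᵐ z ∂(innerRun gA PA UA hUA ω d a₀), ∀ᶠ M in atTop,
          dist (sampleMode νA h K M fun i => (z i).1) (Astar d ω) < ε := by
      filter_upwards [hUA_pos, hA_int d, hwell] with ω hpos hint hx ε hε
      exact exists_forall_ae_dist_sampleMode_innerRun_lt gA PA hUA hνA hrA hgA hirr hpos hint hx hε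
    exact ⟨consistent, fun a₀ K => exists_bandwidth_tendsto_sampleAttack gA PA hUA P
      hA.of_uncurry_left a₀ K consistent⟩
  · have consistent (ε : ℝ) (hε : ε > 0) := exists_forall_ae_dist_sampleMode_outerRun_lt gD pD huD
      (attackDist P Astar hA) hνD hrD hgD hirr huD_pos hD_int hwell hε
    exact ⟨consistent, exists_bandwidth_tendsto_sampleMode_outerRun gD pD huD _ consistent⟩

theorem proposition2 {D A Θ Ω : Type*}
    [MetricSpace D] [MeasurableSpace D] [BorelSpace D] [Nonempty D]
    [MetricSpace A] [MeasurableSpace A] [BorelSpace A]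
    [MetricSpace Θ] [MeasurableSpace Θ] [BorelSpace Θ]
    [MeasurableSpace Ω]
    -- the decision sets, the outcome set, and their reference measures
    (νD : Measure D) [IsDiscreteOrInterval νD]
    (νA : Measure A) [IsDiscreteOrInterval νA]
    (νΘ : Measure Θ) [IsDiscreteOrInterval νΘ]
    -- the space of types of the Attacker
    (P : Measure Ω) [IsProbabilityMeasure P]
    -- utility and probabilities of the Defender
    (uD : D × Θ → ℝ) (huD : Measurable uD) (pD : CondDensity (D × A) νΘ)
    -- random utility and random probabilities of the Attacker
    (UA : Ω → A × Θ → ℝ) (hUA : Measurable (Function.uncurry UA))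
    (PA : CondDensity (Ω × D × A) νΘ)
    -- the random optimal attack
    (Astar : D → Ω → A) (hA : Measurable (Function.uncurry Astar))
    (hAstar : ∀ d, ∀ᵐ ω ∂P, ∀ a,
      attackerExpectedUtility νΘ (fun a θ => UA ω (a, θ)) (fun a => PA.p (ω, d, a)) a ≤
        attackerExpectedUtility νΘ (fun a θ => UA ω (a, θ)) (fun a => PA.p (ω, d, a)) (Astar d ω))
    -- the symmetric proposals
    (gD : CondDensity D νD) (hgD : gD.IsSymmetric)
    (gA : CondDensity A νA) (hgA : gA.IsSymmetric)
    -- positivity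
    (huD_pos : ∀ d θ, 0 < uD (d, θ)) (hUA_pos : ∀ᵐ ω ∂P, ∀ a θ, 0 < UA ω (a, θ))
    (hpD_pos : ∀ d a θ, 0 < pD.p (d, a) θ) (hPA_pos : ∀ᵐ ω ∂P, ∀ d a θ, 0 < PA.p (ω, d, a) θ)
    -- integrability
    (hD_int : Integrable (fun s : D × A × Θ => uD (s.1, s.2.2) * pD.p (s.1, s.2.1) s.2.2)
      (tripleMeasure νD νΘ (attackDist P Astar hA)))
    (hA_int : ∀ d, ∀ᵐ ω ∂P, Integrable
      (fun s : A × Θ => UA ω (s.1, s.2) * PA.p (ω, d, s.1) s.2) (νA.prod νΘ)) :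
    -- 1. the inner chain has the stationary distribution `π_A^ω(a, θ | d)`
    (∀ d, ∀ᵐ ω ∂P,
      IsProbabilityMeasure
        (attackerTarget νA νΘ (fun a θ => UA ω (a, θ)) (fun a => PA.p (ω, d, a))) ∧
      (innerKernel gA PA UA hUA ω d).Invariant
        (attackerTarget νA νΘ (fun a θ => UA ω (a, θ)) (fun a => PA.p (ω, d, a)))) ∧
    -- 2. the outer chain has the stationary distribution `π_D(d, a, θ)`
    (IsProbabilityMeasure (defenderTarget νD uD pD (attackDist P Astar hA)) ∧
      (outerKernel gD pD uD huD (attackDist P Astar hA)).Invariant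
        (defenderTarget νD uD pD (attackDist P Astar hA)) ∧
      -- and so it does, with `p_D(a | d)` replaced by the law of the attack returned by the inner
      -- sampler, if the inner sampler is run with a finite number `M` of iterations
      (∀ (a₀ : A) (h : ℝ) (K M : ℕ), ∃ (q : Kernel D A) (_ : IsMarkovKernel q),
        (∀ d, q d = sampleAttack P gA PA UA hUA d a₀ h K M) ∧
        (Integrable (fun s : D × A × Θ => uD (s.1, s.2.2) * pD.p (s.1, s.2.1) s.2.2)
            (tripleMeasure νD νΘ q) →
          IsProbabilityMeasure (defenderTarget νD uD pD q) ∧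
          (outerKernel gD pD uD huD q).Invariant (defenderTarget νD uD pD q)))) ∧
    -- 3. the inner sampler returns attacks distributed as `p_D(a | d)`, as the run length grows
    (Kernel.IsIrreducible νA gA.kernel →
      ∀ d, (∀ᵐ ω ∂P, IsWellSeparatedArgmax
        (attackerExpectedUtility νΘ (fun a θ => UA ω (a, θ)) (fun a => PA.p (ω, d, a)))
        (Astar d ω)) →
      (∀ᵐ ω ∂P, ∀ ε > 0, ∃ h₀ > 0, ∀ h, 0 < h → h < h₀ → ∀ (a₀ : A) (K : ℕ),
        ∀ᵐ z ∂(innerRun gA PA UA hUA ω d a₀), ∀ᶠ M in atTop,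
          dist (sampleMode νA h K M fun i => (z i).1) (Astar d ω) < ε) ∧
      (∀ (a₀ : A) (K : ℕ), ∃ h : ℕ → ℝ, (∀ M, 0 < h M) ∧ Tendsto h atTop (𝓝 0) ∧
        (∀ M, IsProbabilityMeasure (sampleAttack P gA PA UA hUA d a₀ (h M) K M)) ∧
        ∀ f : A →ᵇ ℝ,
          Tendsto (fun M => ∫ a, f a ∂(sampleAttack P gA PA UA hUA d a₀ (h M) K M)) atTop
            (𝓝 (∫ a, f a ∂(attackDist P Astar hA d))))) ∧
    -- 4. the mode of the draws of `d` approximates the solution `d*_ARA`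
    (Kernel.IsIrreducible νD gD.kernel →
      ∀ dstar, IsWellSeparatedArgmax
        (defenderExpectedUtility uD pD (attackDist P Astar hA)) dstar →
      (∀ ε > 0, ∃ h₀ > 0, ∀ h, 0 < h → h < h₀ → ∀ (d₀ : D) (R : ℕ),
        ∀ᵐ z ∂(outerRun gD pD uD huD (attackDist P Astar hA) d₀), ∀ᶠ N in atTop,
          dist (sampleMode νD h R N fun i => (z i).1) dstar < ε) ∧
      (∀ (d₀ : D) (R : ℕ), ∃ h : ℕ → ℝ, (∀ N, 0 < h N) ∧ Tendsto h atTop (𝓝 0) ∧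
        ∀ᵐ z ∂(outerRun gD pD uD huD (attackDist P Astar hA) d₀),
          Tendsto (fun N => sampleMode νD (h N) R N fun i => (z i).1) atTop (𝓝 dstar))) := by
  have := IsDiscreteOrInterval.secondCountableTopology νD
  have := IsDiscreteOrInterval.secondCountableTopology νA
  exact proposition2_general νD (IsDiscreteOrInterval.hasRegularWindows νD) one_pos νA
    (IsDiscreteOrInterval.hasRegularWindows νA) one_pos νΘ P uD huD pD UA hUA PA Astar hA hAstar
    gD hgD gA hgA huD_pos hUA_pos hD_int hA_int
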